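/- For $s\in\mathbb R$ write $\|u\|_{\ell^2_s}^2=\sum_{k\in\mathbb Z}|k|^{2s}|u(k)|^2$, and for $\rho,\varepsilon>0$ let $$X_\varepsilon^\rho=\Big\{u\in\ell^2(\mathbb Z;\mathbb C):\ u(0)=0,\ u(-n)=\overline{u(n)}\ \text{for all } n,\ \|u\|_{\ell^2}\le\rho\sqrt{\varepsilon},\ \|u\|_{\ell^2_{3/2}}\le\rho/\varepsilon\Big\}.$$ Consider the KdV equation $v_t=6vv_x-v_{xxx}$ on the circle $\mathbb R/2\pi\mathbb Z$. Let $I\ni 0$ be a time interval and let $v\in C(I;H^1)$ be a real solution with mean zero, written as $v(x,t)=\sum_{n\ne0}\sqrt{|n|}\,e^{inx}u(n,t)$, with $u(0,t)=0$. Equivalently, $u\in C(I;\ell^2_{3/2})$, $u(-n,t)=\overline{u(n,t)}$, and the Fourier coefficients $\hat v(n,t)=\sqrt{|n|}\,u(n,t)$ satisfy $$\partial_t\hat v(n)=in^3\hat v(n)+3in\sum_{k\in\mathbb Z}\hat v(k)\hat v(n-k)\qquad (n\in\mathbb Z,\ t\in I).$$ Theorem. Let $\rho>0$. There are constants $C_\delta$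 ($\delta>0$), depending only on $\rho$ and $\delta$, such that for all $\gamma>0$ and $K>0$ there is $\varepsilon_0=\varepsilon_0(\rho,\gamma,K)>0$ with the following property. If $0<\varepsilon<\varepsilon_0$, $u$ is a solution as above and $u(\cdot,0)\in X_\varepsilon^\rho$, then for every $t\in I$ with $|t|\le K\varepsilon^{-1/2+\gamma}$ one has $u(\cdot,t)\in X_\varepsilon^{2\rho}$ and, for every $\delta>0$, $$\big\|u(n,t)-e^{in^3t}u(n,0)\big\|_{\ell^2_{1/2}(n)}\le C_\delta\,\langle t\rangle\,\varepsilon^{1/2-\delta},\qquad \langle t\rangle=\sqrt{1+t^2}.$$ -/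

import Mathlib

open Filter Topology ComplexConjugate

/-- Membership in the weighted space `ℓ²_s(ℤ)`: the series `∑ |k|^{2s} |u(k)|²` converges. -/
def MemWeighted (s : ℝ) (u : ℤ → ℂ) : Prop :=
  Summable fun k : ℤ => |(k : ℝ)| ^ (2 * s) * ‖u k‖ ^ 2

/-- The norm of `ℓ²_s(ℤ)`: `(∑ |k|^{2s} |u(k)|²)^{1/2}` (meaningful for `MemWeighted s u`). -/
noncomputable def weightedNorm (s : ℝ) (u : ℤ → ℂ) : ℝ :=
  Real.sqrt (∑' k : ℤ, |(k : ℝ)| ^ (2 * s) * ‖u k‖ ^ 2)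

/-- The set `X_ε^ρ`. -/
def XSet (ρ ε : ℝ) : Set (ℤ → ℂ) :=
  {u | u 0 = 0 ∧ (∀ n, u (-n) = conj (u n)) ∧
    MemWeighted 0 u ∧ weightedNorm 0 u ≤ ρ * Real.sqrt ε ∧
    MemWeighted (3 / 2) u ∧ weightedNorm (3 / 2) u ≤ ρ / ε}

/-- The Fourier coefficients `√|n| u(n)` of `v(x) = ∑_{n ≠ 0} √|n| e^{inx} u(n)`. -/
noncomputable def vHat (u : ℤ → ℂ) (n : ℤ) : ℂ :=
  (Real.sqrt |(n : ℝ)| : ℂ) * u n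

/-- The `n`-th Fourier coefficient of `6 v v_x - v_xxx = 3 (v²)_x - v_xxx`,
where `w` is the sequence of Fourier coefficients of `v`. -/
noncomputable def kdvRHS (w : ℤ → ℂ) (n : ℤ) : ℂ :=
  3 * (Complex.I * n) * ∑' k : ℤ, w k * w (n - k) - (Complex.I * n) ^ 3 * w n

/-- `u` represents, in the variables `u(n) = v̂(n) / √|n|`, a real, mean-zero solution
`v ∈ C(I; H¹(S¹))` of `v_t = 6 v v_x - v_xxx` on the time interval `I`
(`v ∈ H¹` corresponds to `u ∈ ℓ²_{3/2}`; the equation is tested against each `e^{inx}`,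
and the convolution series converges absolutely for such `u`). -/
structure IsKdVSolution (I : Set ℝ) (u : ℝ → ℤ → ℂ) : Prop where
  zero_mode : ∀ t ∈ I, u t 0 = 0
  real : ∀ t ∈ I, ∀ n, u t (-n) = conj (u t n)
  mem : ∀ t ∈ I, MemWeighted (3 / 2) (u t)
  continuous : ∀ t ∈ I,
    Tendsto (fun s => weightedNorm (3 / 2) (fun n => u s n - u t n)) (𝓝[I] t) (𝓝 0)
  equation : ∀ t ∈ I, ∀ n : ℤ,
    HasDerivWithinAt (fun s => vHat (u s) n) (kdvRHS (vHat (u t)) n) I t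

/-!
With `w = vHat u` the equation reads `w_n' = i n³ w_n + 3 i n ∑_k w_k w_{n-k}`, and `w` has size
`ε^{1/2}` in `H^{-1/2}` and `ε^{-1}` in `H¹`, so by interpolation size `ε^{-r}` in `H^r` for
`-1/2 ≤ r ≤ 1` (`HighFreq.wl2_le`). The nonlinearity is too large for direct use on the time scale
considered, and two normal form steps are used to exploit its oscillation.

The first step divides the quadratic terms by `k³ + l³ - n³ = -3nkl`. In the cubic terms it
produces, the phase is `k³ + a³ + b³ - n³ = -3(k+a)(k+b)(a+b)`; the resonant ones cancel by oddness,
except for `|w_n|² w_n / n` (`tsum_conv₀_eq`), and the second step divides the others by the phase.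
In the new coordinates, after removal of the linear flow, the derivative consists of this
harmless term and of quartic terms with multipliers such as `1 / ((k+a)(k+b)(a+b))`
(`IsBoundedSolution.hasDerivWithinAt_normalForm`).

Both the change of coordinates and this derivative have size `O(ε^{1/2-s-2δ})` in `H^s`, for
`s ∈ [-1/2, 0]` and `s = 1`. Indeed the convolution square is bounded in `ℓ^∞`, which leaves
trilinear sums. Up to a constant the largest of `|k+a|, |k+b|, |a+b|` dominates each of the four
frequencies `k, a, b, n = k+a+b`, so that negative powers of the large frequencies can be gained
from the multiplier, while two square summable factors `|m|^{-1/2-δ}` remain, which allow to sum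
over two of the frequencies (`Admissible`, `tsum_tree_le`, `HighFreq.corr_bound`,
`HighFreq.deriv_bound`). By the mean value theorem the solution differs from the linear one by
`O(⟨t⟩ ε^{1/2-s-2δ})` in `H^s`.

For `s = -1/2` and `s = 1` and `|t| ≤ K ε^{-1/2+γ}` this is smaller than the size of the data in
these spaces, so that a continuity argument (`IsKdVSolution.mem_XSet`) keeps the solution in
`X_ε^{2ρ}` without recourse to conservation laws; `s = 0` is the claimed estimate.
Bounds for `ℓ²` norms are obtained by duality (`DualBound`), with all sums taken in `[0, ∞]`, where
they may be rearranged freely.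
-/

open scoped ENNReal

/-! ### Sums over `ℤ` with values in `[0, ∞]` -/

/-- The `ℓ²(ℤ)` norm of a sequence with values in `[0, ∞]`. -/
noncomputable def l2e (q : ℤ → ℝ≥0∞) : ℝ≥0∞ := (∑' k, q k ^ (2 : ℝ)) ^ (1 / 2 : ℝ)

theorem tsum_mul_le_l2e (p q : ℤ → ℝ≥0∞) : ∑' k, p k * q k ≤ l2e p * l2e q := by
  have h := ENNReal.lintegral_mul_le_Lp_mul_Lq
    (MeasureTheory.Measure.count : MeasureTheory.Measure ℤ) (p := 2) (q := 2)
    (by constructor <;> norm_num) (f := p) (g := q)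
    (measurable_of_countable _).aemeasurable (measurable_of_countable _).aemeasurable
  simpa [MeasureTheory.lintegral_count, l2e] using h

theorem l2e_comp_equiv (q : ℤ → ℝ≥0∞) (e : ℤ ≃ ℤ) : l2e (fun a => q (e a)) = l2e q := by
  unfold l2e
  rw [e.tsum_eq (fun k => q k ^ (2 : ℝ))]

theorem l2e_add_left (q : ℤ → ℝ≥0∞) (k : ℤ) : l2e (fun a => q (k + a)) = l2e q :=
  l2e_comp_equiv q (Equiv.addLeft k)

theorem l2e_sub_right (q : ℤ → ℝ≥0∞) (k : ℤ) : l2e (fun n => q (n - k)) = l2e q :=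
  l2e_comp_equiv q (Equiv.subRight k)

theorem l2e_sub_left (q : ℤ → ℝ≥0∞) (k : ℤ) : l2e (fun n => q (k - n)) = l2e q :=
  l2e_comp_equiv q (Equiv.subLeft k)

theorem l2e_mono {p q : ℤ → ℝ≥0∞} (h : ∀ k, p k ≤ q k) : l2e p ≤ l2e q := by
  unfold l2e
  gcongr with k
  exact h k

/-- A triple sum whose kernel factors along the tree `k — a — n` rooted at `k`. -/
theorem tsum_tree_le {f q h : ℤ → ℝ≥0∞} {K₁ : ℤ → ℤ → ℝ≥0∞} {K₂ : ℤ → ℤ → ℤ → ℝ≥0∞}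
    {A B : ℝ≥0∞} (h₁ : ∀ k, ∑' a, q a * K₁ k a ≤ A) (h₂ : ∀ k a, ∑' n, h n * K₂ k a n ≤ B) :
    ∑' n, h n * ∑' k, ∑' a, f k * q a * (K₁ k a * K₂ k a n) ≤ (∑' k, f k) * A * B := by
  calc ∑' n, h n * ∑' k, ∑' a, f k * q a * (K₁ k a * K₂ k a n)
      = ∑' k, f k * ∑' a, q a * K₁ k a * ∑' n, h n * K₂ k a n := by
        simp_rw [← ENNReal.tsum_mul_left]
        rw [ENNReal.tsum_comm]
        refine tsum_congr fun k => ?_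
        rw [ENNReal.tsum_comm]
        refine tsum_congr fun a => tsum_congr fun n => ?_
        ring
    _ ≤ ∑' k, f k * (A * B) := by
        gcongr with k
        calc ∑' a, q a * K₁ k a * ∑' n, h n * K₂ k a n ≤ ∑' a, q a * K₁ k a * B := by
              gcongr with a
              exact h₂ k a
          _ = (∑' a, q a * K₁ k a) * B := ENNReal.tsum_mul_right
          _ ≤ A * B := by gcongr; exact h₁ k
    _ = _ := by rw [ENNReal.tsum_mul_right, mul_assoc]

/-! The four configurations of two kernel factors that occur. In each of them the sum over `k` uses
the `ℓ¹` norm of `f`, and the sums over `a` and `n` use the Cauchy–Schwarz inequality. -/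

section Kernels

variable (f q h κ : ℤ → ℝ≥0∞)

theorem tsum_kernel_add_sub :
    ∑' n, h n * ∑' k, ∑' a, f k * q a * (κ (k + a) * κ (n - k))
      ≤ (∑' k, f k) * (l2e q * l2e κ) * (l2e h * l2e κ) := by
  refine tsum_tree_le (K₂ := fun k _ n => κ (n - k)) (fun k => ?_) (fun k a => ?_)
  · exact (tsum_mul_le_l2e _ _).trans_eq (by rw [l2e_add_left])
  · exact (tsum_mul_le_l2e _ _).trans_eq (by rw [l2e_sub_right])

theorem tsum_kernel_add_sub' :
    ∑' n, h n * ∑' k, ∑' a, f k * q a * (κ (k + a) * κ (n - a))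
      ≤ (∑' k, f k) * (l2e q * l2e κ) * (l2e h * l2e κ) := by
  refine tsum_tree_le (K₂ := fun _ a n => κ (n - a)) (fun k => ?_) (fun k a => ?_)
  · exact (tsum_mul_le_l2e _ _).trans_eq (by rw [l2e_add_left])
  · exact (tsum_mul_le_l2e _ _).trans_eq (by rw [l2e_sub_right])

theorem tsum_kernel_add_sub_sub :
    ∑' n, h n * ∑' k, ∑' a, f k * q a * (κ (k + a) * κ (n - k - a))
      ≤ (∑' k, f k) * (l2e q * l2e κ) * (l2e h * l2e κ) := by
  refine tsum_tree_le (K₂ := fun k a n => κ (n - k - a)) (fun k => ?_) (fun k a => ?_)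
  · exact (tsum_mul_le_l2e _ _).trans_eq (by rw [l2e_add_left])
  · refine (tsum_mul_le_l2e _ _).trans_eq ?_
    simp_rw [sub_sub]
    rw [l2e_sub_right]

theorem tsum_kernel_sub_sub :
    ∑' n, h n * ∑' k, ∑' a, f k * q a * (κ (n - a) * κ (n - k))
      ≤ (∑' k, f k) * (l2e q * l2e κ) * (l2e h * l2e κ) := by
  calc ∑' n, h n * ∑' k, ∑' a, f k * q a * (κ (n - a) * κ (n - k))
      = ∑' k, f k * ∑' n, h n * κ (n - k) * ∑' a, q a * κ (n - a) := by
        simp_rw [← ENNReal.tsum_mul_left]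
        rw [ENNReal.tsum_comm]
        refine tsum_congr fun k => tsum_congr fun n => tsum_congr fun a => ?_
        ring
    _ ≤ ∑' k, f k * ((l2e h * l2e κ) * (l2e q * l2e κ)) := by
        gcongr with k
        calc ∑' n, h n * κ (n - k) * ∑' a, q a * κ (n - a)
            ≤ ∑' n, h n * κ (n - k) * (l2e q * l2e κ) := by
              gcongr with n
              exact (tsum_mul_le_l2e _ _).trans_eq (by rw [l2e_sub_left])
          _ = (∑' n, h n * κ (n - k)) * (l2e q * l2e κ) := ENNReal.tsum_mul_right
          _ ≤ _ := by
              gcongr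
              exact (tsum_mul_le_l2e _ _).trans_eq (by rw [l2e_sub_right])
    _ = _ := by rw [ENNReal.tsum_mul_right]; ring

/-- Young's inequality `ℓ¹ * ℓ² ⊆ ℓ²`, in dual form. -/
theorem tsum_conv_le :
    ∑' n, h n * ∑' k, f k * q (n - k) ≤ (∑' k, f k) * l2e q * l2e h := by
  calc ∑' n, h n * ∑' k, f k * q (n - k) = ∑' k, f k * ∑' n, h n * q (n - k) := by
        simp_rw [← ENNReal.tsum_mul_left]
        rw [ENNReal.tsum_comm]
        refine tsum_congr fun k => tsum_congr fun n => ?_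
        ring
    _ ≤ ∑' k, f k * (l2e q * l2e h) := by
        gcongr with k
        exact (tsum_mul_le_l2e _ _).trans_eq (by rw [l2e_sub_right, mul_comm])
    _ = _ := by rw [ENNReal.tsum_mul_right, mul_assoc]

end Kernels

/-! ### Pointwise bounds for the multipliers -/

/-- The multiplier inequality in negative regularity: from `A ≤ N + X + Y ≤ 3 N X Y`, all but the
power `-1/2-δ` of `X` and `Y`, together with `N ^ s`, is traded for a power of `A`. -/
theorem rpow_div_mul_le {N A X Y s δ : ℝ} (hN : 1 ≤ N) (hA : 1 ≤ A) (hX : 1 ≤ X) (hY : 1 ≤ Y)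
    (hle : A ≤ N + X + Y) (hs : -(1 / 2) ≤ s) (hs0 : s ≤ 0) (hδ : 0 < δ) (hδ' : δ ≤ 1 / 4) :
    N ^ s / (X * Y) ≤ 3 * A ^ (s + δ) * (X ^ (-(1 / 2) - δ) * Y ^ (-(1 / 2) - δ)) := by
  have hN0 : 0 < N := by linarith
  have hX0 : 0 < X := by linarith
  have hY0 : 0 < Y := by linarith
  have hA0 : 0 < A := by linarith
  have hXY : 1 ≤ X * Y := by nlinarith
  have hXY0 : 0 < X * Y := by positivity
  have key : N ^ s * (X * Y) ^ (-(1 / 2) + δ) ≤ 3 * A ^ (s + δ) := by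
    rcases le_total (s + δ) 0 with h | h
    · have h1 : N ^ s ≤ N ^ (s + δ) := Real.rpow_le_rpow_of_exponent_le hN (by linarith)
      have h2 : (X * Y) ^ (-(1 / 2) + δ) ≤ (X * Y) ^ (s + δ) :=
        Real.rpow_le_rpow_of_exponent_le hXY (by linarith)
      have h3 : A ≤ 3 * (N * (X * Y)) := by
        have e1 : N ≤ N * (X * Y) := by nlinarith
        have e2 : X ≤ N * (X * Y) := by
          calc X ≤ X * Y := by nlinarith
            _ ≤ _ := by nlinarith
        have e3 : Y ≤ N * (X * Y) := by
          calc Y ≤ X * Y := by nlinarith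
            _ ≤ _ := by nlinarith
        linarith
      have h4 : (3 * (N * (X * Y))) ^ (s + δ) ≤ A ^ (s + δ) :=
        Real.rpow_le_rpow_of_nonpos hA0 h3 h
      rw [Real.mul_rpow (by norm_num) (by positivity),
        Real.mul_rpow hN0.le hXY0.le] at h4
      have h5 : (3 : ℝ)⁻¹ ≤ 3 ^ (s + δ) := by
        rw [← Real.rpow_neg_one]
        exact Real.rpow_le_rpow_of_exponent_le (by norm_num) (by linarith)
      have h6 : N ^ s * (X * Y) ^ (-(1 / 2) + δ) ≤ N ^ (s + δ) * (X * Y) ^ (s + δ) := by gcongr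
      have h7 : 0 ≤ N ^ (s + δ) * (X * Y) ^ (s + δ) := by positivity
      nlinarith
    · have h1 : N ^ s ≤ 1 := Real.rpow_le_one_of_one_le_of_nonpos hN hs0
      have h2 : (X * Y) ^ (-(1 / 2) + δ) ≤ 1 :=
        Real.rpow_le_one_of_one_le_of_nonpos hXY (by linarith)
      have h3 : 1 ≤ A ^ (s + δ) := Real.one_le_rpow hA h
      have h4 : N ^ s * (X * Y) ^ (-(1 / 2) + δ) ≤ 1 := mul_le_one₀ h1 (by positivity) h2
      linarith
  have hsplit : N ^ s / (X * Y)
      = N ^ s * (X * Y) ^ (-(1 / 2) + δ) * (X ^ (-(1 / 2) - δ) * Y ^ (-(1 / 2) - δ)) := by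
    rw [← Real.mul_rpow hX0.le hY0.le, mul_assoc, ← Real.rpow_add hXY0,
      show -(1 / 2) + δ + (-(1 / 2) - δ) = (-1 : ℝ) by ring, Real.rpow_neg_one, div_eq_mul_inv]
  rw [hsplit]
  gcongr

/-- The square-summable weight `|m|^{-1/2-δ}`; it vanishes at `m = 0`. -/
noncomputable def kap (δ : ℝ) (m : ℤ) : ℝ := |(m : ℝ)| ^ (-(1 / 2) - δ)

theorem kap_nonneg (δ : ℝ) (m : ℤ) : 0 ≤ kap δ m := by unfold kap; positivity

theorem one_le_abs_cast {m : ℤ} (h : m ≠ 0) : 1 ≤ |(m : ℝ)| := by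
  exact_mod_cast Int.one_le_abs h

theorem inv_le_kap {δ : ℝ} (hδ' : δ ≤ 1 / 4) {m : ℤ} (h : m ≠ 0) : |(m : ℝ)|⁻¹ ≤ kap δ m := by
  unfold kap
  rw [← Real.rpow_neg_one]
  exact Real.rpow_le_rpow_of_exponent_le (one_le_abs_cast h) (by linarith)

/-- Exponents `β, α` such that `|n|^s` times the trilinear multipliers of the second normal form is
controlled by `|k|^β |a|^α` times two factors of the weight `kap δ`. -/
structure Admissible (δ s β α : ℝ) : Prop where
  pair : ∀ {N K L : ℝ}, 1 ≤ N → 1 ≤ K → 1 ≤ L → N ≤ K + L → N ^ s / (K * L) ≤ 2 * (K ^ β * L ^ α)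
  triple : ∀ {n k a : ℤ}, n ≠ 0 → k ≠ 0 → a ≠ 0 → k + a ≠ 0 → n - a ≠ 0 → n - k ≠ 0 →
    |(n : ℝ)| ^ s / (|((k + a : ℤ) : ℝ)| * |((n - a : ℤ) : ℝ)| * |((n - k : ℤ) : ℝ)|)
      ≤ 5 * (|(k : ℝ)| ^ β * |(a : ℝ)| ^ α) * (kap δ (k + a) * kap δ (n - k)
        + kap δ (n - a) * kap δ (n - k) + kap δ (k + a) * kap δ (n - a))

/-- If `Z` is the largest of the three numbers `X, Y, Z` then a bound for `N ^ s / Z` combined with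
a bound for the remaining two factors gives the bound for the triple product; this is symmetrised
over the three possibilities. -/
theorem div_triple_le {P c X Y Z κX κY κZ : ℝ} (hP : 0 ≤ c)
    (hκX : 0 ≤ κX) (hκY : 0 ≤ κY) (hκZ : 0 ≤ κZ)
    (hZ : X ≤ Z → Y ≤ Z → P / (X * Y * Z) ≤ c * (κX * κY))
    (hY : X ≤ Y → Z ≤ Y → P / (X * Y * Z) ≤ c * (κX * κZ))
    (hX : Y ≤ X → Z ≤ X → P / (X * Y * Z) ≤ c * (κY * κZ)) :
    P / (X * Y * Z) ≤ c * (κX * κZ + κY * κZ + κX * κY) := by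
  have h1 : 0 ≤ c * (κX * κZ) := by positivity
  have h2 : 0 ≤ c * (κY * κZ) := by positivity
  have h3 : 0 ≤ c * (κX * κY) := by positivity
  have hsum : c * (κX * κZ + κY * κZ + κX * κY)
      = c * (κX * κZ) + c * (κY * κZ) + c * (κX * κY) := by ring
  rw [hsum]
  rcases le_total X Y with hxy | hxy
  · rcases le_total Y Z with hyz | hyz
    · linarith [hZ (hxy.trans hyz) hyz]
    · linarith [hY hxy hyz]
  · rcases le_total X Z with hxz | hxz
    · linarith [hZ hxz (hxy.trans hxz)]
    · linarith [hX hxy hxz]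

theorem admissible_of_nonpos {δ s : ℝ} (hs : -(1 / 2) ≤ s) (hs0 : s ≤ 0) (hδ : 0 < δ)
    (hδ' : δ ≤ 1 / 4) : Admissible δ s (-1) (s + δ) := by
  refine ⟨fun {N K L} hN hK hL _ => ?_, fun {n k a} hn hk ha h1 h2 h3 => ?_⟩
  · have e1 : N ^ s ≤ 1 := Real.rpow_le_one_of_one_le_of_nonpos hN hs0
    have e2 : L⁻¹ ≤ L ^ (s + δ) := by
      rw [← Real.rpow_neg_one]
      exact Real.rpow_le_rpow_of_exponent_le hL (by linarith)
    rw [Real.rpow_neg_one, div_eq_mul_inv, mul_inv]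
    have : N ^ s * (K⁻¹ * L⁻¹) ≤ 1 * (K⁻¹ * L ^ (s + δ)) := by gcongr
    have h0 : 0 ≤ K⁻¹ * L ^ (s + δ) := by positivity
    linarith
  · set N := |(n : ℝ)|
    set K := |(k : ℝ)|
    set A := |(a : ℝ)|
    have hN : 1 ≤ N := one_le_abs_cast hn
    have hK : 1 ≤ K := one_le_abs_cast hk
    have hA : 1 ≤ A := one_le_abs_cast ha
    have hX := one_le_abs_cast h1
    have hY := one_le_abs_cast h2
    have hZ := one_le_abs_cast h3
    unfold kap
    push_cast at hX hY hZ ⊢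
    set X := |(k : ℝ) + a|
    set Y := |(n : ℝ) - a|
    set Z := |(n : ℝ) - k|
    have r1 : A ≤ N + X + Y := by grind
    have r2 : A ≤ N + X + Z := by grind
    have r3 : A ≤ N + Y + Z := by grind
    have r4 : 2 * K ≤ X + Y + Z := by grind
    have main : ∀ {X Y Z : ℝ}, 1 ≤ X → 1 ≤ Y → 1 ≤ Z → A ≤ N + X + Y → 2 * K ≤ 3 * Z →
        N ^ s / (X * Y * Z) ≤
          5 * (K ^ (-1 : ℝ) * A ^ (s + δ)) * (X ^ (-(1 / 2) - δ) * Y ^ (-(1 / 2) - δ)) := by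
      intro X Y Z hX hY hZ hle h
      have e1 := rpow_div_mul_le hN hA hX hY hle hs hs0 hδ hδ'
      have e2 : Z⁻¹ ≤ 3 / 2 * K ^ (-1 : ℝ) := by
        rw [Real.rpow_neg_one, inv_le_iff_one_le_mul₀ (by positivity)]
        have : K⁻¹ * K = 1 := inv_mul_cancel₀ (by positivity)
        have : 0 < K⁻¹ := by positivity
        nlinarith
      calc N ^ s / (X * Y * Z) = N ^ s / (X * Y) * Z⁻¹ := by
            rw [div_mul_eq_div_div, div_eq_mul_inv _ Z]
        _ ≤ (3 * A ^ (s + δ) * (X ^ (-(1 / 2) - δ) * Y ^ (-(1 / 2) - δ)))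
            * (3 / 2 * K ^ (-1 : ℝ)) := by gcongr
        _ = 9 / 2 * (K ^ (-1 : ℝ) * A ^ (s + δ) *
            (X ^ (-(1 / 2) - δ) * Y ^ (-(1 / 2) - δ))) := by ring
        _ ≤ 5 * (K ^ (-1 : ℝ) * A ^ (s + δ) *
            (X ^ (-(1 / 2) - δ) * Y ^ (-(1 / 2) - δ))) := by gcongr; norm_num
        _ = _ := by ring
    refine div_triple_le (by positivity) (by positivity) (by positivity) (by positivity)
      (fun u v => main hX hY hZ r1 (by linarith)) (fun u v => ?_) (fun u v => ?_)
    · rw [show X * Y * Z = X * Z * Y by ring]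
      exact main hX hZ hY r2 (by linarith)
    · rw [show X * Y * Z = Y * Z * X by ring]
      exact main hY hZ hX r3 (by linarith)

theorem admissible_one {δ : ℝ} (hδ' : δ ≤ 1 / 4) : Admissible δ 1 0 0 := by
  refine ⟨fun {N K L} hN hK hL h => ?_, fun {n k a} hn hk ha h1 h2 h3 => ?_⟩
  · rw [Real.rpow_one, Real.rpow_zero, Real.rpow_zero, div_le_iff₀ (by positivity)]
    nlinarith
  · set N := |(n : ℝ)|
    have hN : 1 ≤ N := one_le_abs_cast hn
    have hX := one_le_abs_cast h1
    have hY := one_le_abs_cast h2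
    have hZ := one_le_abs_cast h3
    have kX := inv_le_kap hδ' h1
    have kY := inv_le_kap hδ' h2
    have kZ := inv_le_kap hδ' h3
    push_cast at hX hY hZ kX kY kZ ⊢
    set X := |(k : ℝ) + a|
    set Y := |(n : ℝ) - a|
    set Z := |(n : ℝ) - k|
    have r4 : 2 * N ≤ X + Y + Z := by grind
    simp only [Real.rpow_one, Real.rpow_zero]
    have main : ∀ {X Y Z κ₁ κ₂ : ℝ}, 1 ≤ X → 1 ≤ Y → 1 ≤ Z → X⁻¹ ≤ κ₁ → Y⁻¹ ≤ κ₂ →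
        2 * N ≤ 3 * Z → N / (X * Y * Z) ≤ 5 * (1 * 1) * (κ₁ * κ₂) := by
      intro X Y Z κ₁ κ₂ hX hY hZ k1 k2 h
      have e2 : N * Z⁻¹ ≤ 5 := by
        rw [← div_eq_mul_inv, div_le_iff₀ (by positivity)]
        linarith
      have hX0 : 0 ≤ X⁻¹ := by positivity
      have : 0 ≤ κ₁ := hX0.trans k1
      calc N / (X * Y * Z) = (N * Z⁻¹) * (X⁻¹ * Y⁻¹) := by
            rw [div_eq_mul_inv, mul_inv, mul_inv]; ring
        _ ≤ 5 * (κ₁ * κ₂) := by gcongr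
        _ = _ := by ring
    refine div_triple_le (by positivity) (kap_nonneg _ _) (kap_nonneg _ _) (kap_nonneg _ _)
      (fun u v => main hX hY hZ kX kY (by linarith)) (fun u v => ?_) (fun u v => ?_)
    · rw [show X * Y * Z = X * Z * Y by ring]
      exact main hX hZ hY kX kZ (by linarith)
    · rw [show X * Y * Z = Y * Z * X by ring]
      exact main hY hZ hX kY kZ (by linarith)

/-! ### Multilinear estimates -/

/-- `F` belongs to `ℓ²(ℤ ∖ {0})` with norm at most `M`, expressed by duality. -/
def DualBound (F : ℤ → ℝ≥0∞) (M : ℝ≥0∞) : Prop :=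
  ∀ h : ℤ → ℝ≥0∞, h 0 = 0 → ∑' n, h n * F n ≤ M * l2e h

theorem DualBound.mono {F F' : ℤ → ℝ≥0∞} {M M' : ℝ≥0∞} (hF : DualBound F M)
    (h : ∀ n, n ≠ 0 → F' n ≤ F n) (hM : M ≤ M') : DualBound F' M' := by
  intro g hg
  refine le_trans (ENNReal.tsum_le_tsum fun n => ?_) ((hF g hg).trans (by gcongr))
  rcases eq_or_ne n 0 with rfl | hn
  · simp [hg]
  · gcongr
    exact h n hn

theorem DualBound.add {F F' : ℤ → ℝ≥0∞} {M M' : ℝ≥0∞} (hF : DualBound F M)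
    (hF' : DualBound F' M') : DualBound (fun n => F n + F' n) (M + M') := by
  intro g hg
  simp_rw [mul_add, ENNReal.tsum_add, add_mul]
  exact add_le_add (hF g hg) (hF' g hg)

theorem DualBound.const_mul {F : ℤ → ℝ≥0∞} {M : ℝ≥0∞} (hF : DualBound F M) (c : ℝ≥0∞) :
    DualBound (fun n => c * F n) (c * M) := by
  intro g hg
  simp_rw [mul_left_comm _ c, ENNReal.tsum_mul_left, mul_assoc]
  gcongr
  exact hF g hg

theorem dualBound_l2e (F : ℤ → ℝ≥0∞) : DualBound F (l2e F) := fun h _ =>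
  (tsum_mul_le_l2e h F).trans_eq (mul_comm _ _)

/-- The weighted sum `∑ |k|^β z(k)`. -/
noncomputable def wl1 (β : ℝ) (z : ℤ → ℝ) : ℝ≥0∞ :=
  ∑' k : ℤ, ENNReal.ofReal (|(k : ℝ)| ^ β * z k)

/-- The weighted norm `(∑ |k|^{2α} z(k)²)^{1/2}`, with values in `[0, ∞]`. -/
noncomputable def wl2 (α : ℝ) (z : ℤ → ℝ) : ℝ≥0∞ :=
  l2e fun k : ℤ => ENNReal.ofReal (|(k : ℝ)| ^ α * z k)

/-- The `ℓ²` norm of the weight `kap δ`. -/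
noncomputable def kapNorm (δ : ℝ) : ℝ≥0∞ := l2e fun m => ENNReal.ofReal (kap δ m)

/-- The modulus of a cubic monomial of frequency `n` with multiplier `1 / ((k+a)(n-a)(n-k))`. -/
noncomputable def mono₁ (z G : ℤ → ℝ) (n k a : ℤ) : ℝ :=
  z k * z a * G (n - k - a) /
    (|((k + a : ℤ) : ℝ)| * |((n - a : ℤ) : ℝ)| * |((n - k : ℤ) : ℝ)|)

/-- The modulus of a cubic monomial of frequency `n` with multiplier `1 / (k(k+a)(n-k))`. -/
noncomputable def mono₂ (z G : ℤ → ℝ) (n k a : ℤ) : ℝ :=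
  z k * z a * G (n - k - a) / (|(k : ℝ)| * |((k + a : ℤ) : ℝ)| * |((n - k : ℤ) : ℝ)|)

/-- The sum of the monomials `mono₁` of frequency `n`. -/
noncomputable def tri₁ (z G : ℤ → ℝ) (n : ℤ) : ℝ≥0∞ :=
  ∑' k : ℤ, ∑' a : ℤ, ENNReal.ofReal (mono₁ z G n k a)

/-- The sum of the monomials `mono₂` of frequency `n`. -/
noncomputable def tri₂ (z G : ℤ → ℝ) (n : ℤ) : ℝ≥0∞ :=
  ∑' k : ℤ, ∑' a : ℤ, ENNReal.ofReal (mono₂ z G n k a)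

/-- The bilinear expression with multiplier `1 / (k(n-k))`. -/
noncomputable def bil (z : ℤ → ℝ) (n : ℤ) : ℝ≥0∞ :=
  ∑' k : ℤ, ENNReal.ofReal (z k * z (n - k) / (|(k : ℝ)| * |((n - k : ℤ) : ℝ)|))

section Estimates

variable {δ s β α : ℝ} {z G : ℤ → ℝ} {Γ : ℝ}

theorem dualBound_bil (hA : Admissible δ s β α) (hz : ∀ k, 0 ≤ z k) (hz0 : z 0 = 0) :
    DualBound (fun n : ℤ => ENNReal.ofReal (|(n : ℝ)| ^ s) * bil z n)
      (2 * (wl1 β z * wl2 α z)) := by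
  intro h h0
  calc ∑' n : ℤ, h n * (ENNReal.ofReal (|(n : ℝ)| ^ s) * bil z n)
      ≤ ∑' n : ℤ, 2 * (h n * ∑' k : ℤ, ENNReal.ofReal (|(k : ℝ)| ^ β * z k) *
          (fun l : ℤ => ENNReal.ofReal (|(l : ℝ)| ^ α * z l)) (n - k)) := by
        refine ENNReal.tsum_le_tsum fun n => ?_
        rcases eq_or_ne n 0 with rfl | hn
        · simp [h0]
        rw [mul_left_comm 2]
        refine mul_le_mul' le_rfl ?_
        rw [bil, ← ENNReal.tsum_mul_left, ← ENNReal.tsum_mul_left]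
        refine ENNReal.tsum_le_tsum fun k => ?_
        have h2 : (2 : ℝ≥0∞) = ENNReal.ofReal 2 := by simp
        have hk1 := hz k
        have hk2 := hz (n - k)
        beta_reduce
        rw [h2, ← ENNReal.ofReal_mul (by positivity), ← ENNReal.ofReal_mul (by positivity),
          ← ENNReal.ofReal_mul (by positivity)]
        refine ENNReal.ofReal_le_ofReal ?_
        rcases eq_or_ne k 0 with rfl | hk
        · simp [hz0]
        rcases eq_or_ne (n - k) 0 with hl | hl
        · simp [hl, hz0]
        have key := hA.pair (one_le_abs_cast hn) (one_le_abs_cast hk) (one_le_abs_cast hl) (by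
          push_cast
          calc |(n : ℝ)| = |(k : ℝ) + (n - k)| := by ring_nf
            _ ≤ _ := abs_add_le _ _)
        calc |(n : ℝ)| ^ s * (z k * z (n - k) / (|(k : ℝ)| * |((n - k : ℤ) : ℝ)|))
            = |(n : ℝ)| ^ s / (|(k : ℝ)| * |((n - k : ℤ) : ℝ)|) * (z k * z (n - k)) := by ring
          _ ≤ 2 * (|(k : ℝ)| ^ β * |((n - k : ℤ) : ℝ)| ^ α) * (z k * z (n - k)) := by gcongr
          _ = _ := by ring
    _ ≤ 2 * (wl1 β z * wl2 α z * l2e h) := by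
        rw [ENNReal.tsum_mul_left]
        gcongr
        exact tsum_conv_le _ _ _
    _ = _ := by ring

theorem dualBound_tri₁ (hA : Admissible δ s β α) (hz : ∀ k, 0 ≤ z k) (hz0 : z 0 = 0)
    (hG0 : ∀ k, 0 ≤ G k) (hG : ∀ k, G k ≤ Γ) :
    DualBound (fun n : ℤ => ENNReal.ofReal (|(n : ℝ)| ^ s) * tri₁ z G n)
      (ENNReal.ofReal (15 * Γ) * (wl1 β z * wl2 α z * kapNorm δ ^ 2)) := by
  intro h h0
  have hΓ : 0 ≤ Γ := (hG0 0).trans (hG 0)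
  set F : ℤ → ℝ≥0∞ := fun k => ENNReal.ofReal (|(k : ℝ)| ^ β * z k) with hF
  set Q : ℤ → ℝ≥0∞ := fun k => ENNReal.ofReal (|(k : ℝ)| ^ α * z k) with hQ
  set κ : ℤ → ℝ≥0∞ := fun m => ENNReal.ofReal (kap δ m) with hκ
  have hpt : ∀ n : ℤ, h n * (ENNReal.ofReal (|(n : ℝ)| ^ s) * tri₁ z G n) ≤
      ENNReal.ofReal (5 * Γ) * (h n * (∑' k, ∑' a, F k * Q a * (κ (k + a) * κ (n - k))) +
        h n * (∑' k, ∑' a, F k * Q a * (κ (n - a) * κ (n - k))) +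
        h n * (∑' k, ∑' a, F k * Q a * (κ (k + a) * κ (n - a)))) := by
    intro n
    rcases eq_or_ne n 0 with rfl | hn
    · simp [h0]
    rw [← mul_add, ← mul_add, mul_left_comm (ENNReal.ofReal (5 * Γ))]
    refine mul_le_mul' le_rfl ?_
    simp_rw [tri₁, mono₁, ← ENNReal.tsum_add, ← ENNReal.tsum_mul_left]
    refine ENNReal.tsum_le_tsum fun k => ENNReal.tsum_le_tsum fun a => ?_
    have hk1 := hz k
    have hk2 := hz a
    have hk3 := hG0 (n - k - a)
    have q1 := kap_nonneg δ (k + a)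
    have q2 := kap_nonneg δ (n - k)
    have q3 := kap_nonneg δ (n - a)
    simp only [hF, hQ, hκ]
    rw [← ENNReal.ofReal_mul (by positivity), ← ENNReal.ofReal_mul (by positivity),
      ← ENNReal.ofReal_mul (by positivity), ← ENNReal.ofReal_mul (by positivity),
      ← ENNReal.ofReal_mul (by positivity), ← ENNReal.ofReal_mul (by positivity),
      ← ENNReal.ofReal_mul (by positivity), ← ENNReal.ofReal_mul (by positivity),
      ← ENNReal.ofReal_add (by positivity) (by positivity),
      ← ENNReal.ofReal_add (by positivity) (by positivity), ← ENNReal.ofReal_mul (by positivity)]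
    refine ENNReal.ofReal_le_ofReal ?_
    by_cases hne : k ≠ 0 ∧ a ≠ 0 ∧ k + a ≠ 0 ∧ n - a ≠ 0 ∧ n - k ≠ 0
    · obtain ⟨e1, e2, e3, e4, e5⟩ := hne
      have key := hA.triple hn e1 e2 e3 e4 e5
      calc _ = |(n : ℝ)| ^ s / (|((k + a : ℤ) : ℝ)| * |((n - a : ℤ) : ℝ)| * |((n - k : ℤ) : ℝ)|)
            * (z k * z a) * G (n - k - a) := by ring
        _ ≤ 5 * (|(k : ℝ)| ^ β * |(a : ℝ)| ^ α) * (kap δ (k + a) * kap δ (n - k)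
              + kap δ (n - a) * kap δ (n - k) + kap δ (k + a) * kap δ (n - a))
            * (z k * z a) * Γ := by gcongr; exact hG _
        _ = _ := by ring
    · have hzero : z k * z a * G (n - k - a) /
          (|((k + a : ℤ) : ℝ)| * |((n - a : ℤ) : ℝ)| * |((n - k : ℤ) : ℝ)|) = 0 := by
        by_contra hcon
        refine hne ⟨?_, ?_, ?_, ?_, ?_⟩ <;> intro hh <;> apply hcon <;>
          first | (subst hh; simp [hz0]) | (rw [hh]; simp)
      rw [hzero, mul_zero]
      positivity
  calc _ ≤ _ := ENNReal.tsum_le_tsum hpt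
    _ ≤ ENNReal.ofReal (5 * Γ) * ((∑' k, F k) * (l2e Q * l2e κ) * (l2e h * l2e κ) +
        (∑' k, F k) * (l2e Q * l2e κ) * (l2e h * l2e κ) +
        (∑' k, F k) * (l2e Q * l2e κ) * (l2e h * l2e κ)) := by
        rw [ENNReal.tsum_mul_left, ENNReal.tsum_add, ENNReal.tsum_add]
        gcongr
        · exact tsum_kernel_add_sub _ _ _ _
        · exact tsum_kernel_sub_sub _ _ _ _
        · exact tsum_kernel_add_sub' _ _ _ _
    _ = ENNReal.ofReal (15 * Γ) * ((∑' k, F k) * l2e Q * l2e κ ^ 2) * l2e h := by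
        rw [show 15 * Γ = 3 * (5 * Γ) by ring, ENNReal.ofReal_mul (p := 3) (by norm_num),
          ENNReal.ofReal_ofNat]
        ring

/-- The second trilinear estimate in negative regularity: the inequality
`|a| ≤ |n| + |k + a| + |n - k|` moves the weight of `n` to `a`. -/
theorem dualBound_tri₂_of_nonpos (hs : -(1 / 2) ≤ s) (hs0 : s ≤ 0) (hδ : 0 < δ)
    (hδ' : δ ≤ 1 / 4) (hz : ∀ k, 0 ≤ z k) (hz0 : z 0 = 0)
    (hG0 : ∀ k, 0 ≤ G k) (hG : ∀ k, G k ≤ Γ) :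
    DualBound (fun n : ℤ => ENNReal.ofReal (|(n : ℝ)| ^ s) * tri₂ z G n)
      (ENNReal.ofReal (3 * Γ) * (wl1 (-1) z * wl2 (s + δ) z * kapNorm δ ^ 2)) := by
  intro h h0
  have hΓ : 0 ≤ Γ := (hG0 0).trans (hG 0)
  set F : ℤ → ℝ≥0∞ := fun k => ENNReal.ofReal (|(k : ℝ)| ^ (-1 : ℝ) * z k) with hF
  set Q : ℤ → ℝ≥0∞ := fun k => ENNReal.ofReal (|(k : ℝ)| ^ (s + δ) * z k) with hQ
  set κ : ℤ → ℝ≥0∞ := fun m => ENNReal.ofReal (kap δ m) with hκ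
  have hpt : ∀ n : ℤ, h n * (ENNReal.ofReal (|(n : ℝ)| ^ s) * tri₂ z G n) ≤
      ENNReal.ofReal (3 * Γ) *
        (h n * (∑' k, ∑' a, F k * Q a * (κ (k + a) * κ (n - k)))) := by
    intro n
    rcases eq_or_ne n 0 with rfl | hn
    · simp [h0]
    rw [mul_left_comm (ENNReal.ofReal (3 * Γ))]
    refine mul_le_mul' le_rfl ?_
    simp_rw [tri₂, mono₂, ← ENNReal.tsum_mul_left]
    refine ENNReal.tsum_le_tsum fun k => ENNReal.tsum_le_tsum fun a => ?_
    have hk1 := hz k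
    have hk2 := hz a
    have hk3 := hG0 (n - k - a)
    have q1 := kap_nonneg δ (k + a)
    have q2 := kap_nonneg δ (n - k)
    simp only [hF, hQ, hκ]
    rw [← ENNReal.ofReal_mul (by positivity), ← ENNReal.ofReal_mul (by positivity),
      ← ENNReal.ofReal_mul (by positivity), ← ENNReal.ofReal_mul (by positivity),
      ← ENNReal.ofReal_mul (by positivity)]
    refine ENNReal.ofReal_le_ofReal ?_
    by_cases hne : k ≠ 0 ∧ a ≠ 0 ∧ k + a ≠ 0 ∧ n - k ≠ 0
    · obtain ⟨e1, e2, e3, e5⟩ := hne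
      have key := rpow_div_mul_le (one_le_abs_cast hn) (one_le_abs_cast e2)
        (one_le_abs_cast e3) (one_le_abs_cast e5) (by push_cast; grind) hs hs0 hδ hδ'
      calc _ = |(n : ℝ)| ^ s / (|((k + a : ℤ) : ℝ)| * |((n - k : ℤ) : ℝ)|)
            * (|(k : ℝ)|⁻¹ * z k * z a) * G (n - k - a) := by
              simp only [div_eq_mul_inv, mul_inv]; ring
        _ ≤ 3 * |(a : ℝ)| ^ (s + δ) * (kap δ (k + a) * kap δ (n - k))
            * (|(k : ℝ)|⁻¹ * z k * z a) * Γ := by unfold kap; gcongr; exact hG _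
        _ = _ := by rw [Real.rpow_neg_one]; ring
    · have hzero : z k * z a * G (n - k - a) /
          (|(k : ℝ)| * |((k + a : ℤ) : ℝ)| * |((n - k : ℤ) : ℝ)|) = 0 := by
        by_contra hcon
        refine hne ⟨?_, ?_, ?_, ?_⟩ <;> intro hh <;> apply hcon <;>
          first | (subst hh; simp [hz0]) | (rw [hh]; simp)
      rw [hzero, mul_zero]
      positivity
  calc _ ≤ _ := ENNReal.tsum_le_tsum hpt
    _ ≤ ENNReal.ofReal (3 * Γ) * ((∑' k, F k) * (l2e Q * l2e κ) * (l2e h * l2e κ)) := by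
        rw [ENNReal.tsum_mul_left]
        gcongr
        exact tsum_kernel_add_sub _ _ _ _
    _ = ENNReal.ofReal (3 * Γ) * ((∑' k, F k) * l2e Q * l2e κ ^ 2) * l2e h := by ring

/-- The second trilinear estimate at regularity one: since `|n| ≤ |k| + |n - k|`, either the
factor `1/k` or the factor `1/(n-k)` is lost, and in the latter case the decay of `G` replaces
it. -/
theorem dualBound_tri₂_one (hδ' : δ ≤ 1 / 4) (hz : ∀ k, 0 ≤ z k) (hz0 : z 0 = 0)
    (hG0 : ∀ k, 0 ≤ G k) (hG : ∀ k, G k ≤ Γ) {Γ' : ℝ} (hG' : ∀ k, G k ≤ Γ' * kap δ k) :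
    DualBound (fun n : ℤ => ENNReal.ofReal (|(n : ℝ)| ^ (1 : ℝ)) * tri₂ z G n)
      ((ENNReal.ofReal Γ * wl1 0 z + ENNReal.ofReal Γ' * wl1 (-1) z)
        * (wl2 0 z * kapNorm δ ^ 2)) := by
  intro h h0
  have hΓ : 0 ≤ Γ := (hG0 0).trans (hG 0)
  have hΓ' : 0 ≤ Γ' := by
    have := (hG0 1).trans (hG' 1)
    simpa [kap] using this
  set F : ℤ → ℝ≥0∞ := fun k => ENNReal.ofReal (|(k : ℝ)| ^ (0 : ℝ) * z k) with hF
  set F' : ℤ → ℝ≥0∞ := fun k => ENNReal.ofReal (|(k : ℝ)| ^ (-1 : ℝ) * z k) with hF'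
  set Q : ℤ → ℝ≥0∞ := fun k => ENNReal.ofReal (|(k : ℝ)| ^ (0 : ℝ) * z k) with hQ
  set κ : ℤ → ℝ≥0∞ := fun m => ENNReal.ofReal (kap δ m) with hκ
  have hpt : ∀ n : ℤ, h n * (ENNReal.ofReal (|(n : ℝ)| ^ (1 : ℝ)) * tri₂ z G n) ≤
      ENNReal.ofReal Γ * (h n * (∑' k, ∑' a, F k * Q a * (κ (k + a) * κ (n - k)))) +
      ENNReal.ofReal Γ' * (h n * (∑' k, ∑' a, F' k * Q a * (κ (k + a) * κ (n - k - a)))) := by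
    intro n
    rw [mul_left_comm (ENNReal.ofReal Γ), mul_left_comm (ENNReal.ofReal Γ'), ← mul_add]
    refine mul_le_mul' le_rfl ?_
    simp_rw [tri₂, mono₂, ← ENNReal.tsum_mul_left, ← ENNReal.tsum_add]
    refine ENNReal.tsum_le_tsum fun k => ENNReal.tsum_le_tsum fun a => ?_
    have hk1 := hz k
    have hk2 := hz a
    have hk3 := hG0 (n - k - a)
    have q1 := kap_nonneg δ (k + a)
    have q2 := kap_nonneg δ (n - k)
    have q3 := kap_nonneg δ (n - k - a)
    simp only [hF, hF', hQ, hκ]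
    rw [← ENNReal.ofReal_mul (by positivity), ← ENNReal.ofReal_mul (by positivity),
      ← ENNReal.ofReal_mul (by positivity), ← ENNReal.ofReal_mul (by positivity),
      ← ENNReal.ofReal_mul (by positivity), ← ENNReal.ofReal_mul (by positivity),
      ← ENNReal.ofReal_mul (by positivity), ← ENNReal.ofReal_mul (by positivity),
      ← ENNReal.ofReal_mul (by positivity), ← ENNReal.ofReal_add (by positivity) (by positivity)]
    refine ENNReal.ofReal_le_ofReal ?_
    simp only [Real.rpow_zero, one_mul, Real.rpow_one, Real.rpow_neg_one]
    by_cases hne : k ≠ 0 ∧ k + a ≠ 0 ∧ n - k ≠ 0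
    · obtain ⟨e1, e3, e5⟩ := hne
      have k1 := inv_le_kap hδ' e3
      have k2 := inv_le_kap hδ' e5
      have hK : |(k : ℝ)| ≠ 0 := by simpa using e1
      have hZ : |((n - k : ℤ) : ℝ)| ≠ 0 := by simpa only [ne_eq, abs_eq_zero, Int.cast_eq_zero]
      have hn : |(n : ℝ)| ≤ |(k : ℝ)| + |((n - k : ℤ) : ℝ)| := by push_cast; grind
      calc |(n : ℝ)| * (z k * z a * G (n - k - a) /
            (|(k : ℝ)| * |((k + a : ℤ) : ℝ)| * |((n - k : ℤ) : ℝ)|))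
          ≤ (|(k : ℝ)| + |((n - k : ℤ) : ℝ)|) * (z k * z a * G (n - k - a) /
            (|(k : ℝ)| * |((k + a : ℤ) : ℝ)| * |((n - k : ℤ) : ℝ)|)) := by gcongr
        _ = G (n - k - a) * (z k * z a * (|((k + a : ℤ) : ℝ)|⁻¹ * |((n - k : ℤ) : ℝ)|⁻¹)) +
            G (n - k - a) * (|(k : ℝ)|⁻¹ * z k * z a * |((k + a : ℤ) : ℝ)|⁻¹) := by
            simp only [div_eq_mul_inv, mul_inv]
            field_simp
        _ ≤ Γ * (z k * z a * (kap δ (k + a) * kap δ (n - k))) +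
            (Γ' * kap δ (n - k - a)) * (|(k : ℝ)|⁻¹ * z k * z a * kap δ (k + a)) := by
            gcongr
            · exact hG _
            · exact hG' _
        _ = _ := by ring
    · have hzero : z k * z a * G (n - k - a) /
          (|(k : ℝ)| * |((k + a : ℤ) : ℝ)| * |((n - k : ℤ) : ℝ)|) = 0 := by
        by_contra hcon
        refine hne ⟨?_, ?_, ?_⟩ <;> intro hh <;> apply hcon <;>
          first | (subst hh; simp [hz0]) | (rw [hh]; simp)
      rw [hzero, mul_zero]
      positivity
  calc _ ≤ _ := ENNReal.tsum_le_tsum hpt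
    _ ≤ ENNReal.ofReal Γ * ((∑' k, F k) * (l2e Q * l2e κ) * (l2e h * l2e κ)) +
        ENNReal.ofReal Γ' * ((∑' k, F' k) * (l2e Q * l2e κ) * (l2e h * l2e κ)) := by
        rw [ENNReal.tsum_add, ENNReal.tsum_mul_left, ENNReal.tsum_mul_left]
        gcongr
        · exact tsum_kernel_add_sub _ _ _ _
        · exact tsum_kernel_add_sub_sub _ _ _ _
    _ = (ENNReal.ofReal Γ * (∑' k, F k) + ENNReal.ofReal Γ' * ∑' k, F' k)
          * (l2e Q * l2e κ ^ 2) * l2e h := by ring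

end Estimates

/-! ### Sequences concentrated at high frequency -/

theorem l2e_le_ofReal_iff {q : ℤ → ℝ≥0∞} {M : ℝ} (hM : 0 ≤ M) :
    l2e q ≤ ENNReal.ofReal M ↔ ∑' k, q k ^ (2 : ℝ) ≤ ENNReal.ofReal (M ^ 2) := by
  unfold l2e
  rw [one_div, ENNReal.rpow_inv_le_iff (by norm_num),
    ENNReal.ofReal_rpow_of_nonneg hM (by norm_num)]
  norm_num

/-- A nonnegative sequence, with `z 0 = 0`, whose `H^{-1/2}` norm is at most `R ε^{1/2}` and whose
`H¹` norm is at most `R ε^{-1}`: its mass sits at frequencies of size about `1/ε`. -/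
structure HighFreq (R ε : ℝ) (z : ℤ → ℝ) : Prop where
  nonneg : ∀ k, 0 ≤ z k
  zero : z 0 = 0
  low : wl2 (-(1 / 2)) z ≤ ENNReal.ofReal (R * ε ^ (1 / 2 : ℝ))
  high : wl2 1 z ≤ ENNReal.ofReal (R * ε ^ (-1 : ℝ))

namespace HighFreq

variable {R ε δ s : ℝ} {z : ℤ → ℝ}

/-- Interpolation between the two defining bounds, from `λ^{2r} ≤ λ^{-1} + λ²` at `λ = ε|k|`. -/
theorem wl2_le (hz : HighFreq R ε z) (hR : 0 ≤ R) (hε : 0 < ε) {r : ℝ} (hr : -(1 / 2) ≤ r)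
    (hr' : r ≤ 1) : wl2 r z ≤ ENNReal.ofReal (2 * R * ε ^ (-r)) := by
  have hlow := (l2e_le_ofReal_iff (by positivity)).1 hz.low
  have hhigh := (l2e_le_ofReal_iff (by positivity)).1 hz.high
  refine (l2e_le_ofReal_iff (by positivity)).2 ?_
  have hpt : ∀ k : ℤ, ENNReal.ofReal (|(k : ℝ)| ^ r * z k) ^ (2 : ℝ) ≤
      ENNReal.ofReal (ε ^ (-(2 * r)) * ε⁻¹) *
        ENNReal.ofReal (|(k : ℝ)| ^ (-(1 / 2) : ℝ) * z k) ^ (2 : ℝ) +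
      ENNReal.ofReal (ε ^ (-(2 * r)) * ε ^ 2) *
        ENNReal.ofReal (|(k : ℝ)| ^ (1 : ℝ) * z k) ^ (2 : ℝ) := by
    intro k
    have hk := hz.nonneg k
    rw [ENNReal.ofReal_rpow_of_nonneg (by positivity) (by norm_num),
      ENNReal.ofReal_rpow_of_nonneg (by positivity) (by norm_num),
      ENNReal.ofReal_rpow_of_nonneg (by positivity) (by norm_num),
      ← ENNReal.ofReal_mul (by positivity), ← ENNReal.ofReal_mul (by positivity),
      ← ENNReal.ofReal_add (by positivity) (by positivity)]
    refine ENNReal.ofReal_le_ofReal ?_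
    norm_num only [Real.rpow_ofNat, Real.rpow_one]
    rcases eq_or_ne k 0 with rfl | hk0
    · simp [hz.zero]
    have hx : 0 < |(k : ℝ)| := by positivity
    generalize |(k : ℝ)| = x at hx
    have hl : 0 < ε * x := by positivity
    have key : (ε * x) ^ (2 * r) ≤ (ε * x) ^ (-1 : ℝ) + (ε * x) ^ (2 : ℝ) := by
      rcases le_total (ε * x) 1 with h | h
      · have : (ε * x) ^ (2 * r) ≤ (ε * x) ^ (-1 : ℝ) :=
          Real.rpow_le_rpow_of_exponent_ge hl h (by linarith)
        have : 0 ≤ (ε * x) ^ (2 : ℝ) := by positivity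
        linarith
      · have : (ε * x) ^ (2 * r) ≤ (ε * x) ^ (2 : ℝ) :=
          Real.rpow_le_rpow_of_exponent_le h (by linarith)
        have : 0 ≤ (ε * x) ^ (-1 : ℝ) := by positivity
        linarith
    rw [Real.mul_rpow hε.le hx.le, Real.rpow_neg_one, Real.rpow_ofNat] at key
    have e1 : (x ^ r) ^ 2 = x ^ (2 * r) := by
      rw [← Real.rpow_natCast, ← Real.rpow_mul hx.le]; congr 1; push_cast; ring
    have e2 : (x ^ (-(1 / 2) : ℝ)) ^ 2 = x⁻¹ := by
      rw [← Real.rpow_natCast, ← Real.rpow_mul hx.le, ← Real.rpow_neg_one]; norm_num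
    have e3 : ε ^ (-(2 * r)) * ε ^ (2 * r) = 1 := by
      rw [← Real.rpow_add hε]; simp
    norm_num only at e2
    rw [mul_pow, mul_pow, mul_pow, e1, e2]
    calc x ^ (2 * r) * z k ^ 2
        = ε ^ (-(2 * r)) * (ε ^ (2 * r) * x ^ (2 * r)) * z k ^ 2 := by
          rw [← mul_assoc, e3, one_mul]
      _ ≤ ε ^ (-(2 * r)) * ((ε * x)⁻¹ + (ε * x) ^ 2) * z k ^ 2 := by gcongr
      _ = _ := by rw [mul_inv]; ring
  calc _ ≤ _ := ENNReal.tsum_le_tsum hpt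
    _ ≤ ENNReal.ofReal (ε ^ (-(2 * r)) * ε⁻¹) * ENNReal.ofReal ((R * ε ^ (1 / 2 : ℝ)) ^ 2) +
        ENNReal.ofReal (ε ^ (-(2 * r)) * ε ^ 2) * ENNReal.ofReal ((R * ε ^ (-1 : ℝ)) ^ 2) := by
        rw [ENNReal.tsum_add, ENNReal.tsum_mul_left, ENNReal.tsum_mul_left]
        gcongr
    _ ≤ _ := by
        rw [← ENNReal.ofReal_mul (by positivity), ← ENNReal.ofReal_mul (by positivity),
          ← ENNReal.ofReal_add (by positivity) (by positivity)]
        refine ENNReal.ofReal_le_ofReal ?_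
        have e1 : (ε ^ (-r)) ^ 2 = ε ^ (-(2 * r)) := by
          rw [← Real.rpow_natCast, ← Real.rpow_mul hε.le]; congr 1; push_cast; ring
        have e2 : (ε ^ (1 / 2 : ℝ)) ^ 2 = ε := by
          rw [← Real.rpow_natCast, ← Real.rpow_mul hε.le]; norm_num
        rw [mul_pow, mul_pow, mul_pow, e1, e2, Real.rpow_neg_one]
        have : 0 ≤ ε ^ (-(2 * r)) * R ^ 2 := by positivity
        have : ε ^ (-(2 * r)) * ε⁻¹ * (R ^ 2 * ε) + ε ^ (-(2 * r)) * ε ^ 2 * (R ^ 2 * ε⁻¹ ^ 2)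
            = 2 * (ε ^ (-(2 * r)) * R ^ 2) := by
          field_simp
          ring
        nlinarith

/-- The weighted `ℓ¹` bound that follows from `wl2_le` and the Cauchy–Schwarz inequality. -/
theorem wl1_le (hz : HighFreq R ε z) (hR : 0 ≤ R) (hε : 0 < ε) {r β : ℝ} (hr : -(1 / 2) ≤ r)
    (hr' : r ≤ 1) (hβ : β = r - 1 / 2 - δ) :
    wl1 β z ≤ kapNorm δ * ENNReal.ofReal (2 * R * ε ^ (-r)) := by
  have h : wl1 β z ≤ kapNorm δ * wl2 r z := by
    refine le_trans (ENNReal.tsum_le_tsum fun k => ?_) (tsum_mul_le_l2e _ _)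
    rw [← ENNReal.ofReal_mul (kap_nonneg _ _)]
    refine ENNReal.ofReal_le_ofReal ?_
    rcases eq_or_ne k 0 with rfl | hk0
    · simp [hz.zero]
    have hx : 0 < |(k : ℝ)| := by positivity
    rw [kap, ← mul_assoc, ← Real.rpow_add hx, hβ]
    refine le_of_eq ?_
    ring_nf
  exact h.trans (by gcongr; exact hz.wl2_le hR hε hr hr')

/-- The regularities of interest: `H^s` with `s ∈ [-1/2, 0]`, and `H¹`. -/
theorem exists_admissible (hz : HighFreq R ε z) (hR : 0 ≤ R) (hε : 0 < ε) (hε1 : ε ≤ 1)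
    (hδ : 0 < δ) (hδ' : δ ≤ 1 / 4) (hs : (-(1 / 2) ≤ s ∧ s ≤ 0) ∨ s = 1) :
    ∃ β α, Admissible δ s β α ∧ wl1 β z * wl2 α z ≤
      kapNorm δ * ENNReal.ofReal (4 * R ^ 2 * ε ^ (1 / 2 - s - 2 * δ)) := by
  rcases hs with ⟨h1, h2⟩ | rfl
  · refine ⟨-1, s + δ, admissible_of_nonpos h1 h2 hδ hδ', ?_⟩
    calc _ ≤ kapNorm δ * ENNReal.ofReal (2 * R * ε ^ (-(-(1 / 2) + δ))) *
          ENNReal.ofReal (2 * R * ε ^ (-(s + δ))) := by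
          gcongr
          · exact hz.wl1_le hR hε (by linarith) (by linarith) (by ring)
          · exact hz.wl2_le hR hε (by linarith) (by linarith)
      _ = _ := by
          rw [mul_assoc, ← ENNReal.ofReal_mul (by positivity)]
          congr 2
          calc _ = 4 * R ^ 2 * (ε ^ (-(-(1 / 2) + δ)) * ε ^ (-(s + δ))) := by ring
            _ = _ := by rw [← Real.rpow_add hε]; ring_nf
  · refine ⟨0, 0, admissible_one hδ', ?_⟩
    calc _ ≤ kapNorm δ * ENNReal.ofReal (2 * R * ε ^ (-(1 / 2 + δ))) *
          ENNReal.ofReal (2 * R * ε ^ (-(0 : ℝ))) := by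
          gcongr
          · exact hz.wl1_le hR hε (by linarith) (by linarith) (by ring)
          · exact hz.wl2_le hR hε (by linarith) (by linarith)
      _ ≤ _ := by
          rw [mul_assoc, ← ENNReal.ofReal_mul (by positivity)]
          refine mul_le_mul' le_rfl (ENNReal.ofReal_le_ofReal ?_)
          have : ε ^ (-(1 / 2 + δ)) ≤ ε ^ (1 / 2 - 1 - 2 * δ) :=
            Real.rpow_le_rpow_of_exponent_ge hε hε1 (by linarith)
          calc _ = 4 * R ^ 2 * ε ^ (-(1 / 2 + δ)) := by simp; ring
            _ ≤ _ := by gcongr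

variable (hz : HighFreq R ε z) (hR : 0 ≤ R) (hε : 0 < ε) (hε1 : ε ≤ 1)
  (hδ : 0 < δ) (hδ' : δ ≤ 1 / 4) (hs : (-(1 / 2) ≤ s ∧ s ≤ 0) ∨ s = 1)

include hz hR hε hε1 hδ hδ' hs

theorem bil_bound : DualBound (fun n : ℤ => ENNReal.ofReal (|(n : ℝ)| ^ s) * bil z n)
    (2 * (kapNorm δ * ENNReal.ofReal (4 * R ^ 2 * ε ^ (1 / 2 - s - 2 * δ)))) := by
  obtain ⟨β, α, hA, hle⟩ := hz.exists_admissible hR hε hε1 hδ hδ' hs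
  exact (dualBound_bil hA hz.nonneg hz.zero).mono (fun _ _ => le_rfl) (by gcongr)

theorem tri₁_bound {G : ℤ → ℝ} {Γ : ℝ} (hG0 : ∀ k, 0 ≤ G k) (hG : ∀ k, G k ≤ Γ) :
    DualBound (fun n : ℤ => ENNReal.ofReal (|(n : ℝ)| ^ s) * tri₁ z G n)
    (ENNReal.ofReal (15 * Γ) *
      (kapNorm δ ^ 3 * ENNReal.ofReal (4 * R ^ 2 * ε ^ (1 / 2 - s - 2 * δ)))) := by
  obtain ⟨β, α, hA, hle⟩ := hz.exists_admissible hR hε hε1 hδ hδ' hs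
  refine (dualBound_tri₁ hA hz.nonneg hz.zero hG0 hG).mono (fun _ _ => le_rfl) ?_
  calc _ ≤ ENNReal.ofReal (15 * Γ) * (kapNorm δ *
        ENNReal.ofReal (4 * R ^ 2 * ε ^ (1 / 2 - s - 2 * δ)) * kapNorm δ ^ 2) := by gcongr
    _ = _ := by ring

theorem tri₂_bound {G : ℤ → ℝ} {Γ : ℝ} (hG0 : ∀ k, 0 ≤ G k) (hG : ∀ k, G k ≤ Γ)
    (hG' : ∀ k, G k ≤ Γ * ε ^ (-(1 / 2) - δ) * kap δ k) :
    DualBound (fun n : ℤ => ENNReal.ofReal (|(n : ℝ)| ^ s) * tri₂ z G n)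
    (ENNReal.ofReal (3 * Γ) *
      (kapNorm δ ^ 3 * ENNReal.ofReal (4 * R ^ 2 * ε ^ (1 / 2 - s - 2 * δ)))) := by
  have hΓ : 0 ≤ Γ := (hG0 0).trans (hG 0)
  have h1 : wl1 (-1) z ≤ kapNorm δ * ENNReal.ofReal (2 * R * ε ^ (-(-(1 / 2) + δ))) :=
    hz.wl1_le hR hε (by linarith) (by linarith) (by ring)
  rcases hs with ⟨hs1, hs2⟩ | rfl
  · refine (dualBound_tri₂_of_nonpos hs1 hs2 hδ hδ' hz.nonneg hz.zero hG0 hG).mono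
      (fun _ _ => le_rfl) ?_
    calc _ ≤ ENNReal.ofReal (3 * Γ) * (kapNorm δ * ENNReal.ofReal (2 * R * ε ^ (-(-(1 / 2) + δ)))
          * ENNReal.ofReal (2 * R * ε ^ (-(s + δ))) * kapNorm δ ^ 2) := by
          gcongr
          exact hz.wl2_le hR hε (by linarith) (by linarith)
      _ = ENNReal.ofReal (3 * Γ) * (kapNorm δ ^ 3 * (ENNReal.ofReal (2 * R * ε ^ (-(-(1 / 2) + δ)))
          * ENNReal.ofReal (2 * R * ε ^ (-(s + δ))))) := by ring
      _ = _ := by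
          rw [← ENNReal.ofReal_mul (by positivity)]
          congr 3
          calc _ = 4 * R ^ 2 * (ε ^ (-(-(1 / 2) + δ)) * ε ^ (-(s + δ))) := by ring
            _ = _ := by rw [← Real.rpow_add hε]; ring_nf
  · refine (dualBound_tri₂_one hδ' hz.nonneg hz.zero hG0 hG hG').mono (fun _ _ => le_rfl) ?_
    have h0 : wl1 0 z ≤ kapNorm δ * ENNReal.ofReal (2 * R * ε ^ (-(1 / 2 + δ))) :=
      hz.wl1_le hR hε (by linarith) (by linarith) (by ring)
    have h2 : wl2 0 z ≤ ENNReal.ofReal (2 * R * ε ^ (-(0 : ℝ))) :=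
      hz.wl2_le hR hε (by linarith) (by linarith)
    calc _ ≤ (ENNReal.ofReal Γ * (kapNorm δ * ENNReal.ofReal (2 * R * ε ^ (-(1 / 2 + δ)))) +
          ENNReal.ofReal (Γ * ε ^ (-(1 / 2) - δ)) *
            (kapNorm δ * ENNReal.ofReal (2 * R * ε ^ (-(-(1 / 2) + δ)))))
          * (ENNReal.ofReal (2 * R * ε ^ (-(0 : ℝ))) * kapNorm δ ^ 2) := by gcongr
      _ = kapNorm δ ^ 3 * ((ENNReal.ofReal Γ * ENNReal.ofReal (2 * R * ε ^ (-(1 / 2 + δ))) +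
          ENNReal.ofReal (Γ * ε ^ (-(1 / 2) - δ)) *
            ENNReal.ofReal (2 * R * ε ^ (-(-(1 / 2) + δ))))
          * ENNReal.ofReal (2 * R * ε ^ (-(0 : ℝ)))) := by ring
      _ ≤ kapNorm δ ^ 3 * (ENNReal.ofReal (3 * Γ) *
          ENNReal.ofReal (4 * R ^ 2 * ε ^ (1 / 2 - 1 - 2 * δ))) := by
          refine mul_le_mul' le_rfl ?_
          rw [← ENNReal.ofReal_mul (by positivity), ← ENNReal.ofReal_mul (by positivity),
            ← ENNReal.ofReal_add (by positivity) (by positivity),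
            ← ENNReal.ofReal_mul (by positivity), ← ENNReal.ofReal_mul (by positivity)]
          refine ENNReal.ofReal_le_ofReal ?_
          have e1 : ε ^ (-(1 / 2 + δ)) ≤ ε ^ (1 / 2 - 1 - 2 * δ) :=
            Real.rpow_le_rpow_of_exponent_ge hε hε1 (by linarith)
          have e2 : ε ^ (-(1 / 2) - δ) * ε ^ (-(-(1 / 2) + δ)) ≤ ε ^ (1 / 2 - 1 - 2 * δ) := by
            rw [← Real.rpow_add hε]
            exact Real.rpow_le_rpow_of_exponent_ge hε hε1 (by linarith)
          have hp : 0 ≤ Γ * R ^ 2 := by positivity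
          calc _ = 4 * (Γ * R ^ 2) * (ε ^ (-(1 / 2 + δ)) +
                ε ^ (-(1 / 2) - δ) * ε ^ (-(-(1 / 2) + δ))) := by simp; ring
            _ ≤ 4 * (Γ * R ^ 2) * (ε ^ (1 / 2 - 1 - 2 * δ) + ε ^ (1 / 2 - 1 - 2 * δ)) := by
                gcongr
            _ = 8 * (Γ * R ^ 2) * ε ^ (1 / 2 - 1 - 2 * δ) := by ring
            _ ≤ 12 * (Γ * R ^ 2) * ε ^ (1 / 2 - 1 - 2 * δ) := by gcongr; norm_num
            _ = _ := by ring
      _ = _ := by ring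

end HighFreq

theorem kapNorm_ne_top {δ : ℝ} (hδ : 0 < δ) : kapNorm δ ≠ ⊤ := by
  have hs : Summable fun m : ℤ => |(m : ℝ)| ^ (-(1 + 2 * δ)) :=
    Real.summable_abs_int_rpow (by linarith)
  unfold kapNorm l2e
  refine ENNReal.rpow_ne_top_of_nonneg (by norm_num) ?_
  have : ∀ m : ℤ, ENNReal.ofReal (kap δ m) ^ (2 : ℝ) =
      ENNReal.ofReal (|(m : ℝ)| ^ (-(1 + 2 * δ))) := by
    intro m
    rw [ENNReal.ofReal_rpow_of_nonneg (kap_nonneg _ _) (by norm_num), kap,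
      ← Real.rpow_mul (abs_nonneg _)]
    congr 2
    ring
  simp_rw [this]
  exact hs.tsum_ofReal_ne_top

/-! ### The terms of the normal form -/

/-- Term-by-term differentiation of a series, within a convex set. -/
theorem hasDerivWithinAt_tsum_of_convex {ι : Type*} {s : Set ℝ} (hs : Convex ℝ s)
    {f f' : ι → ℝ → ℂ} {u : ι → ℝ} (hu : Summable u)
    (hf : ∀ i, ∀ x ∈ s, HasDerivWithinAt (f i) (f' i x) s x)
    (hb : ∀ i, ∀ x ∈ s, ‖f' i x‖ ≤ u i) (hsum : ∀ x ∈ s, Summable fun i => f i x)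
    {x : ℝ} (hx : x ∈ s) :
    HasDerivWithinAt (fun y => ∑' i, f i y) (∑' i, f' i x) s x := by
  rw [hasDerivWithinAt_iff_tendsto_slope]
  have key : Tendsto (fun y => ∑' i, slope (f i) x y) (𝓝[s \ {x}] x) (𝓝 (∑' i, f' i x)) := by
    refine tendsto_tsum_of_dominated_convergence hu
      (fun i => hasDerivWithinAt_iff_tendsto_slope.1 (hf i x hx)) ?_
    filter_upwards [self_mem_nhdsWithin] with y hy i
    have hyx : y - x ≠ 0 := sub_ne_zero.2 fun h => hy.2 h
    have := hs.norm_image_sub_le_of_norm_hasDerivWithin_le (hf i) (hb i) hx hy.1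
    rw [slope_def_module, norm_smul, norm_inv, inv_mul_le_iff₀ (norm_pos_iff.2 hyx), mul_comm]
    exact this
  refine key.congr' ?_
  filter_upwards [self_mem_nhdsWithin] with y hy
  simp_rw [slope_def_module]
  rw [tsum_const_smul'', (hsum y hy.1).tsum_sub (hsum x hx)]

theorem summable_of_tsum_ofReal_ne_top {ι : Type*} {f : ι → ℝ} (hf : ∀ i, 0 ≤ f i)
    (h : ∑' i, ENNReal.ofReal (f i) ≠ ⊤) : Summable f := by
  simpa [ENNReal.toReal_ofReal, hf] using ENNReal.summable_toReal h

/-- The convolution square, i.e. the Fourier coefficients of the square of a function. -/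
noncomputable def conv (w : ℤ → ℂ) (n : ℤ) : ℂ := ∑' k, w k * w (n - k)

/-- `conv w` with its mean value removed. -/
noncomputable def conv₀ (w : ℤ → ℂ) (n : ℤ) : ℂ := if n = 0 then 0 else conv w n

/-- The summands of `nf₁`. -/
noncomputable def nfTerm₁ (w : ℤ → ℂ) (n k : ℤ) : ℂ :=
  w k * w (n - k) / ((k : ℂ) * ((n - k : ℤ) : ℂ))

/-- The quadratic correction of the first normal form step. Terms with a vanishing denominator
are zero by the convention `x / 0 = 0`. -/
noncomputable def nf₁ (w : ℤ → ℂ) (n : ℤ) : ℂ := ∑' k, nfTerm₁ w n k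

/-- The summands of `nf₂`. -/
noncomputable def nfTerm₂ (w : ℤ → ℂ) (n k a : ℤ) : ℂ :=
  w k * w a * w (n - k - a) /
    ((k : ℂ) * ((k + a : ℤ) : ℂ) * ((n - a : ℤ) : ℂ) * ((n - k : ℤ) : ℂ))

/-- The cubic correction of the second normal form step. Resonant terms have a vanishing
denominator, hence are zero by the convention `x / 0 = 0`. -/
noncomputable def nf₂ (w : ℤ → ℂ) (n : ℤ) : ℂ := ∑' p : ℤ × ℤ, nfTerm₂ w n p.1 p.2

/-- The summands of `quart`. -/
noncomputable def quartTerm (w : ℤ → ℂ) (n k a : ℤ) : ℂ :=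
  (k * conv w k * w a * w (n - k - a) + a * conv w a * w k * w (n - k - a) +
    ((n - k - a : ℤ) : ℂ) * conv w (n - k - a) * w k * w a) /
    ((k : ℂ) * ((k + a : ℤ) : ℂ) * ((n - a : ℤ) : ℂ) * ((n - k : ℤ) : ℂ))

/-- The quartic remainder that is left after both normal form steps. -/
noncomputable def quart (w : ℤ → ℂ) (n : ℤ) : ℂ := ∑' p : ℤ × ℤ, quartTerm w n p.1 p.2

section PointwiseBounds

variable {w : ℤ → ℂ} {n : ℤ}

theorem norm_div_intCast_le (x : ℂ) (m : ℤ) : ‖x / (m : ℂ)‖ ≤ ‖x‖ := by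
  rcases eq_or_ne m 0 with rfl | hm
  · simp
  · rw [norm_div, Complex.norm_intCast]
    exact div_le_self (norm_nonneg _) (one_le_abs_cast hm)

theorem norm_nfTerm₁ (k : ℤ) : ‖nfTerm₁ w n k‖
    = ‖w k‖ * ‖w (n - k)‖ / (|(k : ℝ)| * |((n - k : ℤ) : ℝ)|) := by
  simp only [nfTerm₁, norm_div, norm_mul, Complex.norm_intCast]

theorem norm_nfTerm₂_le (k a : ℤ) :
    ‖nfTerm₂ w n k a‖ ≤ mono₂ (fun j => ‖w j‖) (fun j => ‖w j‖) n k a := by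
  have : nfTerm₂ w n k a = w k * w a * w (n - k - a) /
      ((k : ℂ) * ((k + a : ℤ) : ℂ) * ((n - k : ℤ) : ℂ)) / ((n - a : ℤ) : ℂ) := by
    rw [nfTerm₂, div_div]; ring
  rw [this]
  refine (norm_div_intCast_le _ _).trans_eq ?_
  simp only [mono₂, norm_div, norm_mul, Complex.norm_intCast]

/-- The inequality `|b| / (|k| |k + b|) ≤ 1/|k| + 1/|k + b|`. -/
theorem abs_div_mul_abs_le {x k m : ℝ} (h : |x| ≤ |k| + |m|) (hk : k = 0 → x = m) :
    |x| / (|k| * |m|) ≤ 1 / |k| + 1 / |m| := by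
  rcases eq_or_ne k 0 with rfl | hk0
  · simp
  rcases eq_or_ne m 0 with rfl | hm0
  · simp
  have h1 : 0 < |k| := by positivity
  have h2 : 0 < |m| := by positivity
  rw [div_add_div _ _ h1.ne' h2.ne']
  gcongr
  linarith

/-- A majorant for the terms of the quartic remainder. -/
noncomputable def quartMajorant (z G : ℤ → ℝ) (n k a : ℤ) : ℝ :=
  mono₁ z G n (n - k - a) a + (mono₂ z G n k (n - k - a) + mono₁ z G n k (n - k - a)) +
    (mono₂ z G n k a + mono₁ z G n k a)

theorem norm_quartTerm_le (k a : ℤ) :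
    ‖quartTerm w n k a‖ ≤ quartMajorant (fun j => ‖w j‖) (fun j => ‖conv₀ w j‖) n k a := by
  have hmul : ∀ j : ℤ, (j : ℂ) * conv w j = j * conv₀ w j := by
    intro j
    rcases eq_or_ne j 0 with rfl | hj
    · simp
    · simp [conv₀, hj]
  have h0 : ∀ x y z : ℂ, ‖(k : ℂ) * x * y * z /
      ((k : ℂ) * ((k + a : ℤ) : ℂ) * ((n - a : ℤ) : ℂ) * ((n - k : ℤ) : ℂ))‖
      ≤ ‖z‖ * ‖y‖ * ‖x‖ / (|((k + a : ℤ) : ℝ)| * |((n - a : ℤ) : ℝ)| * |((n - k : ℤ) : ℝ)|) := by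
    intro x y z
    rcases eq_or_ne k 0 with rfl | hk
    · simp only [Int.cast_zero, zero_mul, zero_div, norm_zero]; positivity
    · have hk' : (k : ℂ) ≠ 0 := by exact_mod_cast hk
      have : (k : ℂ) * x * y * z /
          ((k : ℂ) * ((k + a : ℤ) : ℂ) * ((n - a : ℤ) : ℂ) * ((n - k : ℤ) : ℂ))
          = z * y * x / (((k + a : ℤ) : ℂ) * ((n - a : ℤ) : ℂ) * ((n - k : ℤ) : ℂ)) := by
        rw [mul_assoc (k : ℂ) x, mul_assoc (k : ℂ), mul_assoc (k : ℂ), mul_assoc (k : ℂ),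
          mul_div_mul_left _ _ hk']
        ring
      rw [this]
      simp only [norm_div, norm_mul, Complex.norm_intCast, le_refl]
  have h1 : ∀ (b c : ℤ) (x y z : ℂ), b = n - k - c → ‖(b : ℂ) * x * y * z /
      ((k : ℂ) * ((k + c : ℤ) : ℂ) * ((n - c : ℤ) : ℂ) * ((n - k : ℤ) : ℂ))‖
      ≤ ‖y‖ * ‖z‖ * ‖x‖ / (|(k : ℝ)| * |((k + c : ℤ) : ℝ)| * |((n - k : ℤ) : ℝ)|) +
        ‖y‖ * ‖z‖ * ‖x‖ /
          (|((k + c : ℤ) : ℝ)| * |((n - c : ℤ) : ℝ)| * |((n - k : ℤ) : ℝ)|) := by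
    intro b c x y z hb
    have key : |(b : ℝ)| / (|(k : ℝ)| * |((n - c : ℤ) : ℝ)|) ≤
        1 / |(k : ℝ)| + 1 / |((n - c : ℤ) : ℝ)| := by
      refine abs_div_mul_abs_le ?_ ?_
      · subst hb; push_cast; grind
      · subst hb; push_cast; intro h; rw [h]; ring
    have hP : 0 ≤ ‖y‖ * ‖z‖ * ‖x‖ / (|((k + c : ℤ) : ℝ)| * |((n - k : ℤ) : ℝ)|) := by positivity
    calc _ = (|(b : ℝ)| / (|(k : ℝ)| * |((n - c : ℤ) : ℝ)|)) *
          (‖y‖ * ‖z‖ * ‖x‖ / (|((k + c : ℤ) : ℝ)| * |((n - k : ℤ) : ℝ)|)) := by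
          simp only [norm_inv, norm_mul, Complex.norm_intCast, div_eq_mul_inv, mul_inv]; ring
      _ ≤ (1 / |(k : ℝ)| + 1 / |((n - c : ℤ) : ℝ)|) *
          (‖y‖ * ‖z‖ * ‖x‖ / (|((k + c : ℤ) : ℝ)| * |((n - k : ℤ) : ℝ)|)) := by gcongr
      _ = _ := by simp only [div_eq_mul_inv, mul_inv]; ring
  have e0 := h0 (conv₀ w k) (w a) (w (n - k - a))
  have e1 := h1 a (n - k - a) (conv₀ w a) (w k) (w (n - k - a)) (by ring)
  have e2 := h1 (n - k - a) a (conv₀ w (n - k - a)) (w k) (w a) rfl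
  have c1 : k + (n - k - a) = n - a := by ring
  have c2 : n - (n - k - a) = k + a := by ring
  have c3 : n - k - (n - k - a) = a := by ring
  have c4 : n - k - a + a = n - k := by ring
  have c5 : k + a - a = k := by ring
  rw [c1, c2] at e1
  simp only [quartTerm, quartMajorant, mono₁, mono₂, hmul, c1, c2, c3, c4, c5]
  rw [add_div, add_div]
  refine (norm_add₃_le).trans (add_le_add (add_le_add (e0.trans_eq ?_) ?_) e2)
  · ring
  · refine le_trans (le_of_eq ?_) (e1.trans_eq ?_)
    · congr 2; ring
    · ring

theorem norm_conv_le : ENNReal.ofReal ‖conv w n‖ ≤ (wl2 0 fun k => ‖w k‖) ^ 2 := by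
  calc ENNReal.ofReal ‖conv w n‖ ≤ ∑' k, ‖w k * w (n - k)‖ₑ := by
        rw [ofReal_norm]; exact enorm_tsum_le_tsum_enorm
    _ = ∑' k, ENNReal.ofReal ‖w k‖ * ENNReal.ofReal ‖w (n - k)‖ := by
        simp_rw [enorm_mul, ofReal_norm]
    _ ≤ _ := tsum_mul_le_l2e _ _
    _ = _ := by
        rw [l2e_sub_left (fun k => ENNReal.ofReal ‖w k‖), ← sq]
        simp [wl2]

end PointwiseBounds

/-! ### Summability and the resonant terms -/

/-- The majorant `M / |k|` of the Fourier coefficients of a function whose `H¹` norm is at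
most `M`. -/
noncomputable def invMajorant (M : ℝ) (k : ℤ) : ℝ := M * |(k : ℝ)|⁻¹

section Majorant

variable {M Γ : ℝ} {n : ℤ}

theorem invMajorant_nonneg (hM : 0 ≤ M) (k : ℤ) : 0 ≤ invMajorant M k := by
  unfold invMajorant; positivity

theorem invMajorant_zero : invMajorant M 0 = 0 := by simp [invMajorant]

theorem wl2_invMajorant_ne_top (hM : 0 ≤ M) {α : ℝ} (hα : α ≤ 1 / 4) :
    wl2 α (invMajorant M) ≠ ⊤ := by
  have hle : wl2 α (invMajorant M) ≤
      l2e fun m => ENNReal.ofReal M * ENNReal.ofReal (kap (1 / 4) m) := by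
    refine l2e_mono fun k => ?_
    rw [← ENNReal.ofReal_mul hM]
    refine ENNReal.ofReal_le_ofReal ?_
    unfold invMajorant kap
    rcases eq_or_ne k 0 with rfl | hk
    · simp only [Int.cast_zero, abs_zero, inv_zero, mul_zero]
      positivity
    · have hx : 0 < |(k : ℝ)| := by positivity
      calc _ = M * (|(k : ℝ)| ^ α * |(k : ℝ)| ^ (-1 : ℝ)) := by rw [Real.rpow_neg_one]; ring
        _ = M * |(k : ℝ)| ^ (α + -1) := by rw [Real.rpow_add hx]
        _ ≤ _ := by
          gcongr
          · exact one_le_abs_cast hk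
          · linarith
  refine ne_top_of_le_ne_top ?_ hle
  have : (l2e fun m => ENNReal.ofReal M * ENNReal.ofReal (kap (1 / 4) m))
      = ENNReal.ofReal M * kapNorm (1 / 4) := by
    unfold kapNorm l2e
    simp_rw [ENNReal.mul_rpow_of_nonneg _ _ (show (0 : ℝ) ≤ 2 by norm_num)]
    rw [ENNReal.tsum_mul_left, ENNReal.mul_rpow_of_nonneg _ _ (by norm_num), ← ENNReal.rpow_mul]
    norm_num
  rw [this]
  exact ENNReal.mul_ne_top ENNReal.ofReal_ne_top (kapNorm_ne_top (by norm_num))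

theorem summable_invMajorant_div (M : ℝ) :
    Summable fun k : ℤ => invMajorant M k / |(k : ℝ)| := by
  have h : Summable fun k : ℤ => |(k : ℝ)| ^ (-2 : ℝ) :=
    Real.summable_abs_int_rpow (by norm_num)
  refine (h.mul_left M).congr fun k => ?_
  rw [Real.rpow_neg (abs_nonneg _), Real.rpow_ofNat, invMajorant, div_eq_mul_inv, sq, mul_inv,
    mul_assoc]

theorem wl1_invMajorant_ne_top (M : ℝ) : wl1 (-1) (invMajorant M) ≠ ⊤ := by
  have := (summable_invMajorant_div M).tsum_ofReal_ne_top
  refine ne_of_eq_of_ne (tsum_congr fun k => ?_) this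
  rw [Real.rpow_neg_one, div_eq_mul_inv, mul_comm]

theorem summable_invMajorant_mul (hM : 0 ≤ M) :
    Summable fun k : ℤ => invMajorant M k * invMajorant M (n - k) := by
  have h0 := invMajorant_nonneg hM
  refine summable_of_tsum_ofReal_ne_top (fun k => mul_nonneg (h0 _) (h0 _)) ?_
  simp_rw [ENNReal.ofReal_mul (h0 _)]
  refine ne_top_of_le_ne_top ?_ (tsum_mul_le_l2e _ _)
  rw [l2e_sub_left (fun k => ENNReal.ofReal (invMajorant M k))]
  have := wl2_invMajorant_ne_top hM (α := 0) (by norm_num)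
  simp only [wl2, Real.rpow_zero, one_mul] at this
  exact ENNReal.mul_ne_top this this

/-- The majorant of `w_k w_a w_b / k`. -/
noncomputable def cubicMajorant (M : ℝ) (n k a : ℤ) : ℝ :=
  invMajorant M k / |(k : ℝ)| * (invMajorant M a * invMajorant M (n - k - a))

theorem summable_cubicMajorant (hM : 0 ≤ M) :
    Summable fun p : ℤ × ℤ => cubicMajorant M n p.1 p.2 := by
  have h0 := invMajorant_nonneg hM
  have h1 : ∀ k : ℤ, 0 ≤ invMajorant M k / |(k : ℝ)| := fun k => div_nonneg (h0 k) (abs_nonneg _)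
  refine summable_of_tsum_ofReal_ne_top
    (fun p => mul_nonneg (h1 _) (mul_nonneg (h0 _) (h0 _))) ?_
  rw [ENNReal.tsum_prod (f := fun k a => ENNReal.ofReal (cubicMajorant M n k a))]
  have hX := wl2_invMajorant_ne_top hM (α := 0) (by norm_num)
  refine ne_top_of_le_ne_top (b := (∑' k : ℤ, ENNReal.ofReal (invMajorant M k / |(k : ℝ)|)) *
    (wl2 0 (invMajorant M) * wl2 0 (invMajorant M))) ?_ ?_
  · exact ENNReal.mul_ne_top (summable_invMajorant_div M).tsum_ofReal_ne_top
      (ENNReal.mul_ne_top hX hX)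
  · rw [← ENNReal.tsum_mul_right]
    refine ENNReal.tsum_le_tsum fun k => ?_
    simp_rw [cubicMajorant, ENNReal.ofReal_mul (h1 _), ENNReal.ofReal_mul (h0 _)]
    rw [ENNReal.tsum_mul_left]
    gcongr
    refine (tsum_mul_le_l2e _ _).trans_eq ?_
    rw [l2e_sub_left (fun k => ENNReal.ofReal (invMajorant M k))]
    simp [wl2]

/-- A dual bound makes each single value finite. -/
theorem ne_top_of_dualBound {F : ℤ → ℝ≥0∞} {B : ℝ≥0∞} (hn : n ≠ 0)
    (h : DualBound (fun n : ℤ => ENNReal.ofReal (|(n : ℝ)| ^ (0 : ℝ)) * F n) B) (hB : B ≠ ⊤) :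
    F n ≠ ⊤ := by
  have h1 := h (Pi.single n 1) (by simp [hn.symm])
  rw [tsum_eq_single n (fun m hm => by simp [hm])] at h1
  have h2 : l2e (Pi.single n 1) = 1 := by
    unfold l2e
    rw [tsum_eq_single n (fun m hm => by simp [hm])]
    simp
  simp only [Pi.single_eq_same, one_mul, Real.rpow_zero, ENNReal.ofReal_one, h2, mul_one] at h1
  exact ne_top_of_le_ne_top hB h1

theorem mono₁_nonneg {z G : ℤ → ℝ} (hz : ∀ k, 0 ≤ z k) (hG : ∀ k, 0 ≤ G k) (k a : ℤ) :
    0 ≤ mono₁ z G n k a :=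
  div_nonneg (mul_nonneg (mul_nonneg (hz _) (hz _)) (hG _)) (by positivity)

theorem mono₂_nonneg {z G : ℤ → ℝ} (hz : ∀ k, 0 ≤ z k) (hG : ∀ k, 0 ≤ G k) (k a : ℤ) :
    0 ≤ mono₂ z G n k a :=
  div_nonneg (mul_nonneg (mul_nonneg (hz _) (hz _)) (hG _)) (by positivity)

theorem quartMajorant_nonneg {z G : ℤ → ℝ} (hz : ∀ k, 0 ≤ z k) (hG : ∀ k, 0 ≤ G k) (k a : ℤ) :
    0 ≤ quartMajorant z G n k a := by
  have h1 := fun k a => mono₁_nonneg (n := n) hz hG k a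
  have h2 := fun k a => mono₂_nonneg (n := n) hz hG k a
  unfold quartMajorant
  exact add_nonneg (add_nonneg (h1 _ _) (add_nonneg (h2 _ _) (h1 _ _)))
    (add_nonneg (h2 _ _) (h1 _ _))

theorem quartMajorant_mono {z z' G G' : ℤ → ℝ} (hz : ∀ k, 0 ≤ z k) (hG : ∀ k, 0 ≤ G k)
    (hz' : ∀ k, z k ≤ z' k) (hG' : ∀ k, G k ≤ G' k) (k a : ℤ) :
    quartMajorant z G n k a ≤ quartMajorant z' G' n k a := by
  have hz'' : ∀ k, 0 ≤ z' k := fun k => (hz k).trans (hz' k)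
  have h1 : ∀ k a, mono₁ z G n k a ≤ mono₁ z' G' n k a := fun k a =>
    div_le_div_of_nonneg_right (mul_le_mul (mul_le_mul (hz' _) (hz' _) (hz _) (hz'' _)) (hG' _)
      (hG _) (mul_nonneg (hz'' _) (hz'' _))) (by positivity)
  have h2 : ∀ k a, mono₂ z G n k a ≤ mono₂ z' G' n k a := fun k a =>
    div_le_div_of_nonneg_right (mul_le_mul (mul_le_mul (hz' _) (hz' _) (hz _) (hz'' _)) (hG' _)
      (hG _) (mul_nonneg (hz'' _) (hz'' _))) (by positivity)
  unfold quartMajorant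
  exact add_le_add (add_le_add (h1 _ _) (add_le_add (h2 _ _) (h1 _ _)))
    (add_le_add (h2 _ _) (h1 _ _))

/-- Summing the majorant, with the frequencies permuted in each piece. -/
theorem tsum_quartMajorant {z G : ℤ → ℝ} (hz : ∀ k, 0 ≤ z k) (hG : ∀ k, 0 ≤ G k) :
    ∑' k, ∑' a, ENNReal.ofReal (quartMajorant z G n k a) = 3 * tri₁ z G n + 2 * tri₂ z G n := by
  have h1 := fun k a => mono₁_nonneg (n := n) hz hG k a
  have h2 := fun k a => mono₂_nonneg (n := n) hz hG k a
  have hrefl : ∀ (f : ℤ → ℝ≥0∞) (c : ℤ), ∑' a, f (c - a) = ∑' a, f a :=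
    fun f c => (Equiv.subLeft c).tsum_eq f
  have e1 : ∑' k, ∑' a, ENNReal.ofReal (mono₁ z G n (n - k - a) a) = tri₁ z G n := by
    calc _ = ∑' a, ∑' k, ENNReal.ofReal (mono₁ z G n (n - a - k) a) := by
          rw [ENNReal.tsum_comm]
          simp_rw [sub_right_comm n]
      _ = ∑' a, ∑' k, ENNReal.ofReal (mono₁ z G n k a) :=
          tsum_congr fun a => hrefl (fun k => ENNReal.ofReal (mono₁ z G n k a)) (n - a)
      _ = _ := ENNReal.tsum_comm
  have e2 : ∑' k, ∑' a, ENNReal.ofReal (mono₁ z G n k (n - k - a)) = tri₁ z G n :=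
    tsum_congr fun k => hrefl (fun a => ENNReal.ofReal (mono₁ z G n k a)) (n - k)
  have e3 : ∑' k, ∑' a, ENNReal.ofReal (mono₂ z G n k (n - k - a)) = tri₂ z G n :=
    tsum_congr fun k => hrefl (fun a => ENNReal.ofReal (mono₂ z G n k a)) (n - k)
  simp_rw [quartMajorant, ENNReal.ofReal_add (add_nonneg (h1 _ _) (add_nonneg (h2 _ _) (h1 _ _)))
    (add_nonneg (h2 _ _) (h1 _ _)), ENNReal.ofReal_add (h1 _ _) (add_nonneg (h2 _ _) (h1 _ _)),
    ENNReal.ofReal_add (h2 _ _) (h1 _ _), ENNReal.tsum_add]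
  rw [e1, e2, e3, ← tri₁, ← tri₂]
  ring

theorem summable_quartMajorant (hM : 0 ≤ M) (hΓ : 0 ≤ Γ) (hn : n ≠ 0) :
    Summable fun p : ℤ × ℤ => quartMajorant (invMajorant M) (fun _ => Γ) n p.1 p.2 := by
  have h0 := invMajorant_nonneg hM
  refine summable_of_tsum_ofReal_ne_top (fun p => quartMajorant_nonneg h0 (fun _ => hΓ) _ _) ?_
  rw [ENNReal.tsum_prod (f := fun k a =>
    ENNReal.ofReal (quartMajorant (invMajorant M) (fun _ => Γ) n k a)),
    tsum_quartMajorant h0 (fun _ => hΓ)]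
  have hA : Admissible (1 / 4) 0 (-1) (0 + 1 / 4) :=
    admissible_of_nonpos (by norm_num) le_rfl (by norm_num) le_rfl
  have hfin : wl1 (-1) (invMajorant M) * wl2 (0 + 1 / 4) (invMajorant M) *
      kapNorm (1 / 4) ^ 2 ≠ ⊤ :=
    ENNReal.mul_ne_top (ENNReal.mul_ne_top (wl1_invMajorant_ne_top M)
      (wl2_invMajorant_ne_top hM (by norm_num)))
      (ENNReal.pow_ne_top (kapNorm_ne_top (by norm_num)))
  refine ENNReal.add_ne_top.2 ⟨ENNReal.mul_ne_top (by norm_num) ?_,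
    ENNReal.mul_ne_top (by norm_num) ?_⟩
  · exact ne_top_of_dualBound hn (dualBound_tri₁ hA h0 invMajorant_zero (Γ := Γ)
      (fun _ => hΓ) (fun _ => le_rfl)) (ENNReal.mul_ne_top ENNReal.ofReal_ne_top hfin)
  · exact ne_top_of_dualBound hn (dualBound_tri₂_of_nonpos (by norm_num) le_rfl (by norm_num)
      le_rfl h0 invMajorant_zero (Γ := Γ) (fun _ => hΓ) (fun _ => le_rfl))
      (ENNReal.mul_ne_top ENNReal.ofReal_ne_top hfin)

end Majorant

section Resonance

variable {w : ℤ → ℂ} {M : ℝ} {n : ℤ}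

/-- The nonresonant cubic terms, i.e. those on which the phase `3(k+a)(n-a)(n-k)` does not
vanish. -/
noncomputable def nonresTerm (w : ℤ → ℂ) (n k a : ℤ) : ℂ :=
  if (k + a) * (n - a) * (n - k) = 0 then 0 else w k * w a * w (n - k - a) / k

theorem norm_cubic_le (hW : ∀ k, ‖w k‖ ≤ invMajorant M k) (k a : ℤ) :
    ‖w k * w a * w (n - k - a) / k‖ ≤ cubicMajorant M n k a := by
  have h0 : ∀ k, 0 ≤ invMajorant M k := fun k => (norm_nonneg _).trans (hW k)
  have h1 := h0 k
  have h2 := h0 a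
  have h3 := h0 (n - k - a)
  rw [norm_div, norm_mul, norm_mul, Complex.norm_intCast, cubicMajorant, div_mul_eq_mul_div,
    mul_assoc]
  gcongr <;> exact hW _

theorem norm_nonresTerm_le (hW : ∀ k, ‖w k‖ ≤ invMajorant M k) (k a : ℤ) :
    ‖nonresTerm w n k a‖ ≤ cubicMajorant M n k a := by
  unfold nonresTerm
  split_ifs
  · rw [norm_zero]
    exact (norm_nonneg _).trans (norm_cubic_le hW k a)
  · exact norm_cubic_le hW k a

/-- The cubic terms are the nonresonant ones up to a single diagonal term: the other resonant terms
add up to a multiple of `∑ w_k w_{-k} / k`, whose summand is odd. -/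
theorem tsum_conv₀_eq (hM : 0 ≤ M) (hW : ∀ k, ‖w k‖ ≤ invMajorant M k) (hn : n ≠ 0) :
    ∑' k : ℤ, conv₀ w (n - k) * w k / k =
      ∑' p : ℤ × ℤ, nonresTerm w n p.1 p.2 - w n * w (-n) * w n / n := by
  have h0 := invMajorant_nonneg hM
  have hw0 : w 0 = 0 := by
    have := hW 0
    rw [invMajorant_zero] at this
    exact norm_le_zero_iff.1 this
  have hsP : Summable fun p : ℤ × ℤ => nonresTerm w n p.1 p.2 :=
    Summable.of_norm_bounded (summable_cubicMajorant hM) fun p => norm_nonresTerm_le hW _ _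
  have hconv : ∀ m, Summable fun a => w a * w (m - a) := fun m => by
    refine Summable.of_norm_bounded (summable_invMajorant_mul (n := m) hM) fun k => ?_
    rw [norm_mul]
    exact mul_le_mul (hW _) (hW _) (norm_nonneg _) (h0 _)
  -- The odd function whose sum vanishes.
  set φ : ℤ → ℂ := fun k => w k * w (-k) / k with hφ
  have hφodd : ∀ k, φ (-k) = -φ k := fun k => by
    simp only [hφ, neg_neg, Int.cast_neg, div_neg]; ring
  have hφs : Summable φ := by
    refine Summable.of_norm_bounded (summable_invMajorant_mul (n := 0) hM) fun k => ?_
    refine (norm_div_intCast_le _ _).trans ?_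
    rw [norm_mul, zero_sub]
    exact mul_le_mul (hW _) (hW _) (norm_nonneg _) (h0 _)
  have hφ0 : ∑' k, φ k = 0 := by
    have h1 := (Equiv.neg ℤ).tsum_eq φ
    simp only [Equiv.neg_apply, hφodd, tsum_neg] at h1
    exact self_eq_neg.1 h1.symm
  have hinner : ∀ k, ∑' a, nonresTerm w n k a = conv₀ w (n - k) * w k / k -
      (2 * w n * φ k - (if k = n then 2 * w n * φ n else 0) -
        (if k = -n then w n * φ (-n) else 0)) := by
    intro k
    rcases eq_or_ne k 0 with rfl | hk
    · have hnn : (0 : ℤ) ≠ -n := by simpa [eq_comm] using hn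
      simp [nonresTerm, hφ, hn.symm, hnn, hw0]
    rcases eq_or_ne k n with rfl | hkn
    · have hnn : ¬ (k = -k) := by omega
      simp [nonresTerm, conv₀, hnn]
    have hnk : n - k ≠ 0 := sub_ne_zero.2 hkn.symm
    have hsum2 : ∑' a, (if a ∈ ({-k, n} : Finset ℤ) then w a * w (n - k - a) else 0) =
        ∑ a ∈ ({-k, n} : Finset ℤ), w a * w (n - k - a) := by
      rw [tsum_eq_sum (s := {-k, n}) (fun a ha => by rw [if_neg ha])]
      exact Finset.sum_congr rfl fun a ha => by rw [if_pos ha]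
    have hterm : ∀ a, nonresTerm w n k a = w k / k * (w a * w (n - k - a) -
        (if a ∈ ({-k, n} : Finset ℤ) then w a * w (n - k - a) else 0)) := by
      intro a
      have hiff : (k + a) * (n - a) * (n - k) = 0 ↔ a ∈ ({-k, n} : Finset ℤ) := by
        simp only [mul_eq_zero, hnk, or_false, Finset.mem_insert, Finset.mem_singleton]
        omega
      unfold nonresTerm
      simp only [hiff]
      split_ifs
      · simp
      · ring
    have hfin : Summable fun a =>
        (if a ∈ ({-k, n} : Finset ℤ) then w a * w (n - k - a) else 0) :=
      summable_of_ne_finset_zero (s := {-k, n}) fun a ha => by rw [if_neg ha]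
    simp_rw [hterm]
    rw [tsum_mul_left, (hconv (n - k)).tsum_sub hfin, hsum2]
    simp only [conv₀, hnk, if_false, conv, hkn]
    rcases eq_or_ne k (-n) with hkn' | hkn'
    · subst hkn'
      simp only [neg_neg, Finset.pair_eq_singleton, Finset.sum_singleton, hφ, if_true,
        sub_neg_eq_add, add_sub_cancel_right]
      ring
    · have : -k ≠ n := by omega
      rw [Finset.sum_pair this, if_neg hkn']
      have c1 : n - k - -k = n := by ring
      have c2 : n - k - n = -k := by ring
      rw [c1, c2]
      simp only [hφ]
      ring
  have hr : HasSum (fun k => 2 * w n * φ k - (if k = n then 2 * w n * φ n else 0) -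
      (if k = -n then w n * φ (-n) else 0)) (2 * w n * 0 - 2 * w n * φ n - w n * φ (-n)) := by
    refine ((HasSum.mul_left _ (hφs.hasSum_iff.2 hφ0)).sub ?_).sub ?_
    · exact hasSum_ite_eq n _
    · exact hasSum_ite_eq (-n) _
  have hs1 : Summable fun k => ∑' a, nonresTerm w n k a := hsP.prod
  have : ∀ k, conv₀ w (n - k) * w k / k = ∑' a, nonresTerm w n k a +
      (2 * w n * φ k - (if k = n then 2 * w n * φ n else 0) -
        (if k = -n then w n * φ (-n) else 0)) := fun k => by rw [hinner]; ring
  rw [hsP.tsum_prod, tsum_congr this, hs1.tsum_add hr.summable, hr.tsum_eq, hφodd]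
  simp only [hφ]
  ring

end Resonance

/-! ### Differentiating the normal form -/

/-- The Fourier coefficients of a solution on the time interval `J`, with a uniform bound for
`|k| |w_k|` and for the coefficients of the square. -/
structure IsBoundedSolution (J : Set ℝ) (w : ℝ → ℤ → ℂ) (M Γ : ℝ) : Prop where
  nonneg : 0 ≤ M
  nonneg' : 0 ≤ Γ
  bound : ∀ t ∈ J, ∀ k, ‖w t k‖ ≤ invMajorant M k
  conv_bound : ∀ t ∈ J, ∀ k, ‖conv (w t) k‖ ≤ Γ
  deriv : ∀ t ∈ J, ∀ n : ℤ, HasDerivWithinAt (fun s => w s n)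
    (Complex.I * n ^ 3 * w t n + 3 * Complex.I * n * conv (w t) n) J t

/-- The solution `w` in normal form coordinates, in the interaction representation. -/
noncomputable def normalForm (w : ℝ → ℤ → ℂ) (n : ℤ) (t : ℝ) : ℂ :=
  Complex.exp (-(Complex.I * n ^ 3 * t)) * (w t n + nf₁ (w t) n + 2 * nf₂ (w t) n)

namespace IsBoundedSolution

variable {J : Set ℝ} {w : ℝ → ℤ → ℂ} {M Γ : ℝ} {n : ℤ} {t : ℝ}

theorem zero (hw : IsBoundedSolution J w M Γ) (ht : t ∈ J) : w t 0 = 0 := by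
  have := hw.bound t ht 0
  rw [invMajorant_zero] at this
  exact norm_le_zero_iff.1 this

theorem conv₀_bound (hw : IsBoundedSolution J w M Γ) (ht : t ∈ J) (k : ℤ) :
    ‖conv₀ (w t) k‖ ≤ Γ := by
  unfold conv₀
  split_ifs
  · simpa using hw.nonneg'
  · exact hw.conv_bound t ht k

theorem norm_mul_le (hw : IsBoundedSolution J w M Γ) (ht : t ∈ J) (k l : ℤ) :
    ‖w t k * w t l‖ ≤ invMajorant M k * invMajorant M l := by
  rw [norm_mul]
  exact mul_le_mul (hw.bound t ht _) (hw.bound t ht _) (norm_nonneg _)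
    (invMajorant_nonneg hw.nonneg _)

theorem norm_nfTerm₁_le (hw : IsBoundedSolution J w M Γ) (ht : t ∈ J) (k : ℤ) :
    ‖nfTerm₁ (w t) n k‖ ≤ invMajorant M k * invMajorant M (n - k) := by
  rw [nfTerm₁, ← div_div]
  exact ((norm_div_intCast_le _ _).trans (norm_div_intCast_le _ _)).trans (hw.norm_mul_le ht _ _)

theorem norm_conv₀_div_le (hw : IsBoundedSolution J w M Γ) (ht : t ∈ J) (k l : ℤ) :
    ‖conv₀ (w t) l * w t k / k‖ ≤ Γ * (invMajorant M k / |(k : ℝ)|) := by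
  rw [norm_div, norm_mul, Complex.norm_intCast, mul_div_assoc]
  have := hw.bound t ht k
  have := hw.nonneg'
  gcongr
  exact hw.conv₀_bound ht _

theorem norm_nfTerm₂_le_cubicMajorant (hw : IsBoundedSolution J w M Γ) (ht : t ∈ J) (k a : ℤ) :
    ‖nfTerm₂ (w t) n k a‖ ≤ cubicMajorant M n k a := by
  have : nfTerm₂ (w t) n k a = w t k * w t a * w t (n - k - a) / k / ((k + a : ℤ) : ℂ) /
      ((n - a : ℤ) : ℂ) / ((n - k : ℤ) : ℂ) := by
    simp only [nfTerm₂, div_div, mul_assoc]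
  rw [this]
  exact (norm_div_intCast_le _ _).trans ((norm_div_intCast_le _ _).trans
    ((norm_div_intCast_le _ _).trans (norm_cubic_le (hw.bound t ht) k a)))

/-- First normal form step, based on `k³ + l³ = n³ - 3nkl` for `n = k + l`. -/
theorem hasDerivWithinAt_nf₁ (hw : IsBoundedSolution J w M Γ) (hJ : Convex ℝ J) (ht : t ∈ J) :
    HasDerivWithinAt (fun s => nf₁ (w s) n)
      (Complex.I * n ^ 3 * nf₁ (w t) n - 3 * Complex.I * n * conv (w t) n +
        6 * Complex.I * ∑' k : ℤ, conv₀ (w t) (n - k) * w t k / k) J t := by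
  have hM := hw.nonneg
  set I := Complex.I
  have hI : ‖I‖ = 1 := Complex.norm_I
  let f' : ℤ → ℝ → ℂ := fun k s => I * n ^ 3 * nfTerm₁ (w s) n k - 3 * I * n * (w s k * w s (n - k))
    + 3 * I * (conv₀ (w s) (n - k) * w s k / k)
    + 3 * I * (conv₀ (w s) k * w s (n - k) / ((n - k : ℤ) : ℂ))
  have hs0 := summable_invMajorant_mul (n := n) hM
  have hs1 := summable_invMajorant_div M
  have hs2 : Summable fun k : ℤ => invMajorant M (n - k) / |((n - k : ℤ) : ℝ)| :=
    (Equiv.subLeft n).summable_iff.2 hs1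
  have hderiv : ∀ k, ∀ s ∈ J, HasDerivWithinAt (fun y => nfTerm₁ (w y) n k) (f' k s) J s := by
    intro k s hs
    have h := ((hw.deriv s hs k).mul (hw.deriv s hs (n - k))).div_const
      ((k : ℂ) * ((n - k : ℤ) : ℂ))
    refine h.congr_deriv ?_
    simp only [f', nfTerm₁, conv₀]
    rcases eq_or_ne k 0 with rfl | hk
    · simp [hw.zero hs]
    rcases eq_or_ne (n - k) 0 with hl | hl
    · simp [hl, hw.zero hs]
    have hk' : (k : ℂ) ≠ 0 := by exact_mod_cast hk
    have hl' : ((n - k : ℤ) : ℂ) ≠ 0 := by exact_mod_cast hl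
    have hn : (n : ℂ) = k + ((n - k : ℤ) : ℂ) := by push_cast; ring
    rw [if_neg hk, if_neg hl, hn]
    generalize ((n - k : ℤ) : ℂ) = l at *
    field_simp
    ring
  have hb : ∀ k, ∀ s ∈ J, ‖f' k s‖ ≤ (|(n : ℝ)| ^ 3 + 3 * |(n : ℝ)|) *
      (invMajorant M k * invMajorant M (n - k)) + 3 * (Γ * (invMajorant M k / |(k : ℝ)|)) +
      3 * (Γ * (invMajorant M (n - k) / |((n - k : ℤ) : ℝ)|)) := by
    intro k s hs
    refine (norm_add₃_le).trans (add_le_add (add_le_add ?_ ?_) ?_)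
    · refine (norm_sub_le _ _).trans ?_
      rw [add_mul]
      simp only [norm_mul, norm_pow, hI, Complex.norm_intCast, Complex.norm_ofNat, one_mul, mul_one]
      have e1 := hw.norm_nfTerm₁_le (n := n) hs k
      have e2 := hw.norm_mul_le hs k (n - k)
      rw [norm_mul] at e2
      gcongr
    · rw [norm_mul, norm_mul, hI, Complex.norm_ofNat, mul_one]
      gcongr
      exact hw.norm_conv₀_div_le hs _ _
    · rw [norm_mul, norm_mul, hI, Complex.norm_ofNat, mul_one]
      gcongr
      exact hw.norm_conv₀_div_le hs _ _
  have key := hasDerivWithinAt_tsum_of_convex hJ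
    (((hs0.mul_left (|(n : ℝ)| ^ 3 + 3 * |(n : ℝ)|)).add ((hs1.mul_left Γ).mul_left 3)).add
      ((hs2.mul_left Γ).mul_left 3))
    hderiv hb (fun s hs => Summable.of_norm_bounded hs0 fun k => hw.norm_nfTerm₁_le hs k) ht
  refine key.congr_deriv ?_
  have t1 : Summable fun k => nfTerm₁ (w t) n k :=
    Summable.of_norm_bounded hs0 fun k => hw.norm_nfTerm₁_le ht k
  have t2 : Summable fun k => w t k * w t (n - k) :=
    Summable.of_norm_bounded hs0 fun k => hw.norm_mul_le ht k _
  have t3 : Summable fun k : ℤ => conv₀ (w t) (n - k) * w t k / k :=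
    Summable.of_norm_bounded (hs1.mul_left Γ) fun k => hw.norm_conv₀_div_le ht k _
  have t4 : Summable fun k : ℤ => conv₀ (w t) k * w t (n - k) / ((n - k : ℤ) : ℂ) :=
    Summable.of_norm_bounded (hs2.mul_left Γ) fun k => hw.norm_conv₀_div_le ht _ _
  have hrefl : ∑' k : ℤ, conv₀ (w t) k * w t (n - k) / ((n - k : ℤ) : ℂ) =
      ∑' k : ℤ, conv₀ (w t) (n - k) * w t k / k := by
    rw [← (Equiv.subLeft n).tsum_eq]
    simp [Equiv.subLeft_apply]
  simp only [f']
  rw [(((t1.mul_left _).sub (t2.mul_left _)).add (t3.mul_left _)).tsum_add (t4.mul_left _),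
    ((t1.mul_left _).sub (t2.mul_left _)).tsum_add (t3.mul_left _),
    (t1.mul_left _).tsum_sub (t2.mul_left _)]
  simp_rw [tsum_mul_left]
  rw [hrefl, ← conv, ← nf₁]
  ring

/-- Second normal form step, based on `k³ + a³ + b³ = n³ - 3(k+a)(k+b)(a+b)` for
`n = k + a + b`. -/
theorem hasDerivWithinAt_nf₂ (hw : IsBoundedSolution J w M Γ) (hJ : Convex ℝ J) (ht : t ∈ J)
    (hn : n ≠ 0) :
    HasDerivWithinAt (fun s => nf₂ (w s) n)
      (Complex.I * n ^ 3 * nf₂ (w t) n -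
        3 * Complex.I * ∑' p : ℤ × ℤ, nonresTerm (w t) n p.1 p.2 +
        3 * Complex.I * quart (w t) n) J t := by
  have hM := hw.nonneg
  have hΓ := hw.nonneg'
  set I := Complex.I
  have hI : ‖I‖ = 1 := Complex.norm_I
  let f' : ℤ × ℤ → ℝ → ℂ := fun p s => I * n ^ 3 * nfTerm₂ (w s) n p.1 p.2
    - 3 * I * nonresTerm (w s) n p.1 p.2 + 3 * I * quartTerm (w s) n p.1 p.2
  have hs0 := summable_cubicMajorant (n := n) hM
  have hs1 := summable_quartMajorant hM hΓ hn
  have hq : ∀ s ∈ J, ∀ k a, ‖quartTerm (w s) n k a‖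
      ≤ quartMajorant (invMajorant M) (fun _ => Γ) n k a := fun s hs k a =>
    (norm_quartTerm_le k a).trans (quartMajorant_mono (fun _ => norm_nonneg _)
      (fun _ => norm_nonneg _) (hw.bound s hs) (hw.conv₀_bound hs) k a)
  have hderiv : ∀ p, ∀ s ∈ J,
      HasDerivWithinAt (fun y => nfTerm₂ (w y) n p.1 p.2) (f' p s) J s := by
    rintro ⟨k, a⟩ s hs
    have h := (((hw.deriv s hs k).mul (hw.deriv s hs a)).mul (hw.deriv s hs (n - k - a))).div_const
      ((k : ℂ) * ((k + a : ℤ) : ℂ) * ((n - a : ℤ) : ℂ) * ((n - k : ℤ) : ℂ))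
    refine h.congr_deriv ?_
    simp only [f', nfTerm₂, quartTerm, nonresTerm, Pi.mul_apply, I]
    rcases eq_or_ne k 0 with rfl | hk
    · simp
    have hk' : (k : ℂ) ≠ 0 := by exact_mod_cast hk
    split_ifs with hres
    · rcases mul_eq_zero.1 hres with hres | hres
      · rcases mul_eq_zero.1 hres with hres | hres <;> simp [hres]
      · simp [hres]
    · have h1 : k + a ≠ 0 := fun h => hres (by rw [h]; ring)
      have h2 : n - a ≠ 0 := fun h => hres (by rw [h]; ring)
      have h3 : n - k ≠ 0 := fun h => hres (by rw [h]; ring)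
      have h1' : ((k + a : ℤ) : ℂ) ≠ 0 := by exact_mod_cast h1
      have h2' : ((n - a : ℤ) : ℂ) ≠ 0 := by exact_mod_cast h2
      have h3' : ((n - k : ℤ) : ℂ) ≠ 0 := by exact_mod_cast h3
      push_cast at h1' h2' h3' ⊢
      field_simp
      ring
  have hb : ∀ p, ∀ s ∈ J, ‖f' p s‖ ≤ (|(n : ℝ)| ^ 3 + 3) * cubicMajorant M n p.1 p.2 +
      3 * quartMajorant (invMajorant M) (fun _ => Γ) n p.1 p.2 := by
    intro p s hs
    refine (norm_add_le _ _).trans (add_le_add ((norm_sub_le _ _).trans ?_) ?_)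
    · rw [add_mul]
      simp only [norm_mul, norm_pow, hI, Complex.norm_intCast, Complex.norm_ofNat, one_mul, mul_one]
      have e1 := hw.norm_nfTerm₂_le_cubicMajorant (n := n) hs p.1 p.2
      have e2 := norm_nonresTerm_le (n := n) (hw.bound s hs) p.1 p.2
      gcongr
    · rw [norm_mul, norm_mul, hI, Complex.norm_ofNat, mul_one]
      gcongr
      exact hq s hs _ _
  have key := hasDerivWithinAt_tsum_of_convex hJ
    ((hs0.mul_left (|(n : ℝ)| ^ 3 + 3)).add (hs1.mul_left 3))
    hderiv hb (fun s hs => Summable.of_norm_bounded hs0 fun p =>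
      hw.norm_nfTerm₂_le_cubicMajorant hs _ _) ht
  refine key.congr_deriv ?_
  have t1 : Summable fun p : ℤ × ℤ => nfTerm₂ (w t) n p.1 p.2 :=
    Summable.of_norm_bounded hs0 fun p => hw.norm_nfTerm₂_le_cubicMajorant ht _ _
  have t2 : Summable fun p : ℤ × ℤ => nonresTerm (w t) n p.1 p.2 :=
    Summable.of_norm_bounded hs0 fun p => norm_nonresTerm_le (hw.bound t ht) _ _
  have t3 : Summable fun p : ℤ × ℤ => quartTerm (w t) n p.1 p.2 :=
    Summable.of_norm_bounded hs1 fun p => hq t ht _ _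
  simp only [f']
  rw [((t1.mul_left _).sub (t2.mul_left _)).tsum_add (t3.mul_left _),
    (t1.mul_left _).tsum_sub (t2.mul_left _)]
  simp_rw [tsum_mul_left]
  rw [← quart, ← nf₂]

/-- In normal form coordinates only one resonant cubic term and the quartic term are left. -/
theorem hasDerivWithinAt_normalForm (hw : IsBoundedSolution J w M Γ) (hJ : Convex ℝ J)
    (ht : t ∈ J) (hn : n ≠ 0) :
    HasDerivWithinAt (normalForm w n)
      (Complex.exp (-(Complex.I * n ^ 3 * t)) * (6 * Complex.I *
        (quart (w t) n - w t n * w t (-n) * w t n / n))) J t := by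
  have hexp : HasDerivWithinAt (fun s : ℝ => Complex.exp (-(Complex.I * n ^ 3 * s)))
      (Complex.exp (-(Complex.I * n ^ 3 * t)) * -(Complex.I * n ^ 3 * 1)) J t :=
    ((((hasDerivAt_id t).ofReal_comp.hasDerivWithinAt (s := J)).const_mul
      (Complex.I * (n : ℂ) ^ 3)).neg).cexp
  refine (hexp.mul (((hw.deriv t ht n).add (hw.hasDerivWithinAt_nf₁ hJ ht)).add
    ((hw.hasDerivWithinAt_nf₂ hJ ht hn).const_mul 2))).congr_deriv ?_
  simp only [Pi.add_apply]
  rw [tsum_conv₀_eq hw.nonneg (hw.bound t ht) hn]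
  ring

end IsBoundedSolution

/-! ### Bounds for the normal form of a high frequency solution -/

theorem le_l2e (q : ℤ → ℝ≥0∞) (k : ℤ) : q k ≤ l2e q := by
  unfold l2e
  rw [one_div, ENNReal.le_rpow_inv_iff (by norm_num)]
  exact ENNReal.le_tsum k

theorem le_of_wl2_le {z : ℤ → ℝ} {r B : ℝ} (hB : 0 ≤ B) (h : wl2 r z ≤ ENNReal.ofReal B) (k : ℤ) :
    |(k : ℝ)| ^ r * z k ≤ B :=
  (ENNReal.ofReal_le_ofReal_iff hB).1 ((le_l2e _ k).trans h)

theorem le_mul_kap_of_abs_rpow_mul_le {x B δ : ℝ} {k : ℤ} (hk : k ≠ 0)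
    (h : |(k : ℝ)| ^ (1 / 2 + δ) * x ≤ B) : x ≤ B * kap δ k := by
  have hpos : 0 < |(k : ℝ)| := by positivity
  have hinv : |(k : ℝ)| ^ (1 / 2 + δ) * kap δ k = 1 := by
    rw [kap, ← Real.rpow_add hpos]
    simp
  calc x = |(k : ℝ)| ^ (1 / 2 + δ) * kap δ k * x := by rw [hinv, one_mul]
    _ = |(k : ℝ)| ^ (1 / 2 + δ) * x * kap δ k := by ring
    _ ≤ B * kap δ k := mul_le_mul_of_nonneg_right h (kap_nonneg _ _)

/-- The constant in the bound for the normal form corrections. -/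
noncomputable def corrConst (R δ : ℝ) : ℝ≥0∞ :=
  2 * (kapNorm δ * ENNReal.ofReal (4 * R ^ 2)) +
    2 * (ENNReal.ofReal (3 * (2 * R)) * (kapNorm δ ^ 3 * ENNReal.ofReal (4 * R ^ 2)))

/-- The constant in the bound for the derivative of the normal form. -/
noncomputable def derivConst (R δ : ℝ) : ℝ≥0∞ :=
  6 * ((3 * (ENNReal.ofReal (15 * (8 * R ^ 2)) * (kapNorm δ ^ 3 * ENNReal.ofReal (4 * R ^ 2))) +
    2 * (ENNReal.ofReal (3 * (8 * R ^ 2)) * (kapNorm δ ^ 3 * ENNReal.ofReal (4 * R ^ 2)))) +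
    ENNReal.ofReal (2 * R ^ 3))

theorem corrConst_ne_top (R : ℝ) {δ : ℝ} (hδ : 0 < δ) : corrConst R δ ≠ ⊤ := by
  have := kapNorm_ne_top hδ
  have h3 : kapNorm δ ^ 3 ≠ ⊤ := ENNReal.pow_ne_top this
  unfold corrConst
  simp [ENNReal.mul_eq_top, this]

theorem derivConst_ne_top (R : ℝ) {δ : ℝ} (hδ : 0 < δ) : derivConst R δ ≠ ⊤ := by
  have := kapNorm_ne_top hδ
  unfold derivConst
  simp [ENNReal.mul_eq_top, this]

namespace HighFreq

variable {R ε δ s : ℝ} {w : ℤ → ℂ}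

theorem norm_conv_le (hz : HighFreq R ε fun k => ‖w k‖) (hR : 0 ≤ R) (hε : 0 < ε) (k : ℤ) :
    ‖conv w k‖ ≤ 4 * R ^ 2 := by
  have h0 : wl2 0 (fun k => ‖w k‖) ≤ ENNReal.ofReal (2 * R) := by
    simpa using hz.wl2_le hR hε (r := 0) (by norm_num) (by norm_num)
  have h1 : ENNReal.ofReal ‖conv w k‖ ≤ ENNReal.ofReal (2 * R) ^ 2 :=
    _root_.norm_conv_le.trans (by gcongr)
  rw [← ENNReal.ofReal_pow (by positivity), ENNReal.ofReal_le_ofReal_iff (by positivity)] at h1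
  linarith

/-- The square of a function is as smooth as the function: `|b|^r ≤ |k|^r + |b - k|^r`. -/
theorem rpow_mul_norm_conv_le (hz : HighFreq R ε fun k => ‖w k‖) (hR : 0 ≤ R) (hε : 0 < ε)
    {r : ℝ} (hr : 0 ≤ r) (hr' : r ≤ 1) (b : ℤ) :
    |(b : ℝ)| ^ r * ‖conv w b‖ ≤ 8 * R ^ 2 * ε ^ (-r) := by
  have h0 : wl2 0 (fun k => ‖w k‖) ≤ ENNReal.ofReal (2 * R) := by
    simpa using hz.wl2_le hR hε (r := 0) (by norm_num) (by norm_num)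
  have h1 : wl2 r (fun k => ‖w k‖) ≤ ENNReal.ofReal (2 * R * ε ^ (-r)) :=
    hz.wl2_le hR hε (by linarith) hr'
  simp only [wl2, Real.rpow_zero, one_mul] at h0
  rw [wl2] at h1
  rw [← ENNReal.ofReal_le_ofReal_iff (by positivity), ENNReal.ofReal_mul (by positivity)]
  set p : ℤ → ℝ≥0∞ := fun k => ENNReal.ofReal ‖w k‖
  set q : ℤ → ℝ≥0∞ := fun k => ENNReal.ofReal (|(k : ℝ)| ^ r * ‖w k‖)
  calc ENNReal.ofReal (|(b : ℝ)| ^ r) * ENNReal.ofReal ‖conv w b‖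
      ≤ ENNReal.ofReal (|(b : ℝ)| ^ r) * ∑' k, ‖w k * w (b - k)‖ₑ := by
        rw [ofReal_norm ]
        gcongr
        exact enorm_tsum_le_tsum_enorm
    _ ≤ ∑' k, (q k * p (b - k) + p k * q (b - k)) := by
        rw [← ENNReal.tsum_mul_left]
        refine ENNReal.tsum_le_tsum fun k => ?_
        simp only [p, q]
        rw [← ofReal_norm, norm_mul, ← ENNReal.ofReal_mul (by positivity),
          ← ENNReal.ofReal_mul (by positivity), ← ENNReal.ofReal_mul (by positivity),
          ← ENNReal.ofReal_add (by positivity) (by positivity)]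
        refine ENNReal.ofReal_le_ofReal ?_
        have e : |(b : ℝ)| ^ r ≤ |(k : ℝ)| ^ r + |((b - k : ℤ) : ℝ)| ^ r := by
          refine le_trans (Real.rpow_le_rpow (abs_nonneg _) ?_ hr)
            (Real.rpow_add_le_add_rpow (abs_nonneg _) (abs_nonneg _) hr hr')
          push_cast
          grind
        calc _ ≤ (|(k : ℝ)| ^ r + |((b - k : ℤ) : ℝ)| ^ r) * (‖w k‖ * ‖w (b - k)‖) := by gcongr
          _ = _ := by ring
    _ ≤ l2e q * l2e p + l2e p * l2e q := by
        rw [ENNReal.tsum_add]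
        refine add_le_add ((tsum_mul_le_l2e _ _).trans_eq ?_) ((tsum_mul_le_l2e _ _).trans_eq ?_)
        · rw [l2e_sub_left p]
        · rw [l2e_sub_left q]
    _ ≤ ENNReal.ofReal (2 * R * ε ^ (-r)) * ENNReal.ofReal (2 * R) +
        ENNReal.ofReal (2 * R) * ENNReal.ofReal (2 * R * ε ^ (-r)) := by gcongr
    _ = _ := by
        rw [← ENNReal.ofReal_mul (by positivity), ← ENNReal.ofReal_mul (by positivity),
          ← ENNReal.ofReal_add (by positivity) (by positivity)]
        congr 1
        ring

/-- The normal form corrections are small in `H^s`. -/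
theorem corr_bound (hz : HighFreq R ε fun k => ‖w k‖) (hR : 0 ≤ R) (hε : 0 < ε) (hε1 : ε ≤ 1)
    (hδ : 0 < δ) (hδ' : δ ≤ 1 / 4) (hs : (-(1 / 2) ≤ s ∧ s ≤ 0) ∨ s = 1) :
    DualBound (fun n : ℤ => ENNReal.ofReal (|(n : ℝ)| ^ s) * ‖nf₁ w n + 2 * nf₂ w n‖ₑ)
      (corrConst R δ * ENNReal.ofReal (ε ^ (1 / 2 - s - 2 * δ))) := by
  have hsup : ∀ k, ‖w k‖ ≤ 2 * R := fun k => by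
    simpa using le_of_wl2_le (by positivity)
      (hz.wl2_le hR hε (r := 0) (by norm_num) (by norm_num)) k
  have hdec : ∀ k, ‖w k‖ ≤ 2 * R * ε ^ (-(1 / 2) - δ) * kap δ k := fun k => by
    rcases eq_or_ne k 0 with rfl | hk
    · have : ‖w 0‖ = 0 := hz.zero
      rw [this]
      have := kap_nonneg δ 0
      positivity
    · refine le_mul_kap_of_abs_rpow_mul_le hk ?_
      have := le_of_wl2_le (by positivity)
        (hz.wl2_le hR hε (r := 1 / 2 + δ) (by linarith) (by linarith)) k
      rwa [neg_add] at this
  have h1 := hz.bil_bound hR hε hε1 hδ hδ' hs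
  have h2 := hz.tri₂_bound hR hε hε1 hδ hδ' hs (G := fun k => ‖w k‖) (fun _ => norm_nonneg _)
    hsup hdec
  refine (h1.add (h2.const_mul 2)).mono (fun n _ => ?_) ?_
  · rw [mul_left_comm, ← mul_add]
    gcongr
    refine (enorm_add_le _ _).trans (add_le_add ?_ ?_)
    · refine enorm_tsum_le_tsum_enorm.trans_eq (tsum_congr fun k => ?_)
      rw [← ofReal_norm, norm_nfTerm₁]
    · rw [enorm_mul]
      have : ‖(2 : ℂ)‖ₑ = 2 := by rw [← ofReal_norm]; simp
      rw [this]
      gcongr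
      refine enorm_tsum_le_tsum_enorm.trans ?_
      rw [ENNReal.tsum_prod (f := fun k a => ‖nfTerm₂ w n k a‖ₑ)]
      refine ENNReal.tsum_le_tsum fun k => ENNReal.tsum_le_tsum fun a => ?_
      rw [← ofReal_norm]
      exact ENNReal.ofReal_le_ofReal (norm_nfTerm₂_le k a)
  · rw [ENNReal.ofReal_mul (by positivity), corrConst]
    refine le_of_eq ?_
    ring

/-- The derivative of the normal form is small in `H^s`. -/
theorem deriv_bound (hz : HighFreq R ε fun k => ‖w k‖) (hreal : ∀ n, w (-n) = conj (w n))
    (hR : 0 ≤ R) (hε : 0 < ε) (hε1 : ε ≤ 1)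
    (hδ : 0 < δ) (hδ' : δ ≤ 1 / 4) (hs : (-(1 / 2) ≤ s ∧ s ≤ 0) ∨ s = 1) :
    DualBound (fun n : ℤ => ENNReal.ofReal (|(n : ℝ)| ^ s) *
        ‖6 * Complex.I * (quart w n - w n * w (-n) * w n / n)‖ₑ)
      (derivConst R δ * ENNReal.ofReal (ε ^ (1 / 2 - s - 2 * δ))) := by
  have hsup : ∀ k, ‖conv₀ w k‖ ≤ 8 * R ^ 2 := fun k => by
    unfold conv₀
    split_ifs
    · rw [norm_zero]; positivity
    · exact (hz.norm_conv_le hR hε k).trans (by nlinarith [sq_nonneg R])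
  have hdec : ∀ k, ‖conv₀ w k‖ ≤ 8 * R ^ 2 * ε ^ (-(1 / 2) - δ) * kap δ k := fun k => by
    unfold conv₀
    split_ifs with hk
    · rw [norm_zero]
      have := kap_nonneg δ k
      positivity
    · refine le_mul_kap_of_abs_rpow_mul_le hk ?_
      have := hz.rpow_mul_norm_conv_le hR hε (r := 1 / 2 + δ) (by linarith) (by linarith) k
      rwa [neg_add] at this
  have h1 := hz.tri₁_bound hR hε hε1 hδ hδ' hs (G := fun k => ‖conv₀ w k‖)
    (fun _ => norm_nonneg _) hsup
  have h2 := hz.tri₂_bound hR hε hε1 hδ hδ' hs (G := fun k => ‖conv₀ w k‖)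
    (fun _ => norm_nonneg _) hsup hdec
  have hs' : -(1 / 2) ≤ s ∧ s ≤ 1 := by
    rcases hs with h | rfl
    · constructor <;> linarith
    · norm_num
  have h3 : DualBound (fun n : ℤ => ENNReal.ofReal (|(n : ℝ)| ^ s) * ‖w n * w (-n) * w n / n‖ₑ)
      (ENNReal.ofReal (2 * R ^ 3 * ε ^ (1 / 2 - s - 2 * δ))) := by
    refine ((dualBound_l2e fun n : ℤ => ENNReal.ofReal (|(n : ℝ)| ^ s * ‖w n‖)).const_mul
      (ENNReal.ofReal (R ^ 2 * ε))).mono (fun n hn => ?_) ?_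
    · rw [← ofReal_norm, ← ENNReal.ofReal_mul (by positivity), ← ENNReal.ofReal_mul (by positivity)]
      refine ENNReal.ofReal_le_ofReal ?_
      have e1 := le_of_wl2_le (by positivity) hz.low n
      have hx : 0 < |(n : ℝ)| := by positivity
      have e2 : ‖w n‖ ^ 2 / |(n : ℝ)| ≤ R ^ 2 * ε := by
        calc ‖w n‖ ^ 2 / |(n : ℝ)| = (|(n : ℝ)| ^ (-(1 / 2) : ℝ) * ‖w n‖) ^ 2 := by
              have : (|(n : ℝ)| ^ (-(1 / 2) : ℝ)) ^ 2 = |(n : ℝ)|⁻¹ := by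
                rw [← Real.rpow_natCast, ← Real.rpow_mul hx.le, ← Real.rpow_neg_one]; norm_num
              rw [mul_pow, this, div_eq_inv_mul]
          _ ≤ (R * ε ^ (1 / 2 : ℝ)) ^ 2 := by gcongr
          _ = R ^ 2 * ε := by
              have : (ε ^ (1 / 2 : ℝ)) ^ 2 = ε := by
                rw [← Real.rpow_natCast, ← Real.rpow_mul hε.le]; norm_num
              rw [mul_pow, this]
      have hnorm : ‖w n * w (-n) * w n / n‖ = ‖w n‖ ^ 2 / |(n : ℝ)| * ‖w n‖ := by
        rw [hreal, norm_div, norm_mul, norm_mul, Complex.norm_conj, Complex.norm_intCast]; ring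
      rw [hnorm]
      calc |(n : ℝ)| ^ s * (‖w n‖ ^ 2 / |(n : ℝ)| * ‖w n‖)
          = ‖w n‖ ^ 2 / |(n : ℝ)| * (|(n : ℝ)| ^ s * ‖w n‖) := by ring
        _ ≤ _ := by gcongr
    · have e := hz.wl2_le hR hε hs'.1 hs'.2
      rw [wl2] at e
      refine (mul_le_mul' le_rfl e).trans ?_
      rw [← ENNReal.ofReal_mul (by positivity)]
      refine ENNReal.ofReal_le_ofReal ?_
      calc R ^ 2 * ε * (2 * R * ε ^ (-s)) = 2 * R ^ 3 * (ε ^ (1 : ℝ) * ε ^ (-s)) := by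
            rw [Real.rpow_one]; ring
        _ ≤ 2 * R ^ 3 * ε ^ (1 / 2 - s - 2 * δ) := by
            rw [← Real.rpow_add hε]
            gcongr 2 * R ^ 3 * ?_
            exact Real.rpow_le_rpow_of_exponent_ge hε hε1 (by linarith)
  refine ((((h1.const_mul 3).add (h2.const_mul 2)).add h3).const_mul 6).mono (fun n _ => ?_) ?_
  · rw [mul_left_comm 3, mul_left_comm 2, ← mul_add, ← mul_add, mul_left_comm 6]
    gcongr
    have h6 : ‖6 * Complex.I‖ₑ = 6 := by rw [← ofReal_norm]; simp
    rw [enorm_mul, h6]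
    gcongr
    refine enorm_sub_le.trans ?_
    gcongr
    rw [← tsum_quartMajorant (fun _ => norm_nonneg _) (fun _ => norm_nonneg _)]
    refine enorm_tsum_le_tsum_enorm.trans ?_
    rw [ENNReal.tsum_prod (f := fun k a => ‖quartTerm w n k a‖ₑ)]
    refine ENNReal.tsum_le_tsum fun k => ENNReal.tsum_le_tsum fun a => ?_
    rw [← ofReal_norm]
    exact ENNReal.ofReal_le_ofReal (norm_quartTerm_le k a)
  · rw [ENNReal.ofReal_mul (p := 4 * R ^ 2) (by positivity),
      ENNReal.ofReal_mul (p := 2 * R ^ 3) (by positivity), derivConst]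
    refine le_of_eq ?_
    ring

end HighFreq

/-! ### Near-linear evolution -/

/-- Pairing with a finitely supported sequence, in real terms. -/
theorem DualBound.sum_le {F : ℤ → ℂ} {s B : ℝ} (hB : 0 ≤ B)
    (h : DualBound (fun n : ℤ => ENNReal.ofReal (|(n : ℝ)| ^ s) * ‖F n‖ₑ) (ENNReal.ofReal B))
    {H : Finset ℤ} (hH : 0 ∉ H) {c : ℤ → ℝ} (hc : ∀ n, 0 ≤ c n) :
    ∑ n ∈ H, c n * (|(n : ℝ)| ^ s * ‖F n‖) ≤ B * √(∑ n ∈ H, c n ^ 2) := by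
  have h1 := h (fun n => if n ∈ H then ENNReal.ofReal (c n) else 0) (by simp [hH])
  rw [tsum_eq_sum (s := H) (fun n hn => by simp [hn])] at h1
  have e1 : ∑ n ∈ H, (if n ∈ H then ENNReal.ofReal (c n) else 0) *
      (ENNReal.ofReal (|(n : ℝ)| ^ s) * ‖F n‖ₑ) =
      ENNReal.ofReal (∑ n ∈ H, c n * (|(n : ℝ)| ^ s * ‖F n‖)) := by
    rw [ENNReal.ofReal_sum_of_nonneg fun n _ => by have := hc n; positivity]
    refine Finset.sum_congr rfl fun n hn => ?_
    rw [if_pos hn, ← ofReal_norm, ENNReal.ofReal_mul (hc n), ENNReal.ofReal_mul (by positivity)]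
  have e2 : l2e (fun n => if n ∈ H then ENNReal.ofReal (c n) else 0) =
      ENNReal.ofReal √(∑ n ∈ H, c n ^ 2) := by
    unfold l2e
    rw [tsum_eq_sum (s := H) (fun n hn => by simp [hn]), Real.sqrt_eq_rpow,
      ← ENNReal.ofReal_rpow_of_nonneg (Finset.sum_nonneg fun n _ => sq_nonneg _) (by norm_num),
      ENNReal.ofReal_sum_of_nonneg fun n _ => sq_nonneg _]
    congr 1
    refine Finset.sum_congr rfl fun n hn => ?_
    simp only [hn, if_true]
    rw [ENNReal.ofReal_rpow_of_nonneg (hc n) (by norm_num), Real.rpow_ofNat]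
  rw [e1, e2, ← ENNReal.ofReal_mul hB] at h1
  exact (ENNReal.ofReal_le_ofReal_iff (by positivity)).1 h1

theorem wl2_le_of_sum_le {z : ℤ → ℝ} {s B : ℝ} (hz : ∀ k, 0 ≤ z k) (hz0 : z 0 = 0) (hB : 0 ≤ B)
    (h : ∀ H : Finset ℤ, 0 ∉ H → ∑ n ∈ H, (|(n : ℝ)| ^ s * z n) ^ 2 ≤ B ^ 2) :
    wl2 s z ≤ ENNReal.ofReal B := by
  refine (l2e_le_ofReal_iff hB).2 (ENNReal.summable.tsum_le_of_sum_le fun H => ?_)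
  have e : ∀ n : ℤ, ENNReal.ofReal (|(n : ℝ)| ^ s * z n) ^ (2 : ℝ)
      = ENNReal.ofReal ((|(n : ℝ)| ^ s * z n) ^ 2) := fun n => by
    have := hz n
    rw [ENNReal.ofReal_rpow_of_nonneg (by positivity) (by norm_num), Real.rpow_ofNat]
  simp_rw [e]
  rw [← ENNReal.ofReal_sum_of_nonneg fun n _ => sq_nonneg _,
    ← Finset.sum_erase H (a := 0) (by simp [hz0])]
  exact ENNReal.ofReal_le_ofReal (h _ (by simp))

theorem norm_exp_I_mul_pow (n : ℤ) (t : ℝ) : ‖Complex.exp (Complex.I * n ^ 3 * t)‖ = 1 := by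
  have : Complex.I * (n : ℂ) ^ 3 * t = ((n ^ 3 * t : ℝ) : ℂ) * Complex.I := by
    push_cast; ring
  rw [this, Complex.norm_exp_ofReal_mul_I]

theorem norm_exp_neg_I_mul_pow (n : ℤ) (t : ℝ) :
    ‖Complex.exp (-(Complex.I * n ^ 3 * t))‖ = 1 := by
  rw [Complex.exp_neg, norm_inv, norm_exp_I_mul_pow, inv_one]

/-- The constant of the near-linearity estimate. -/
noncomputable def nearLinearConst (R δ : ℝ) : ℝ := 3 * (corrConst R δ + derivConst R δ).toReal

theorem nearLinearConst_nonneg (R δ : ℝ) : 0 ≤ nearLinearConst R δ := by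
  unfold nearLinearConst; positivity

/-- Near-linear evolution in `H^s`, for as long as the solution stays at high frequency. -/
theorem IsBoundedSolution.wl2_sub_le {w : ℝ → ℤ → ℂ} {M Γ τ R ε δ s : ℝ}
    (hw : IsBoundedSolution (Set.uIcc 0 τ) w M Γ)
    (hreal : ∀ t ∈ Set.uIcc 0 τ, ∀ n, w t (-n) = conj (w t n))
    (hz : ∀ t ∈ Set.uIcc 0 τ, HighFreq R ε fun k => ‖w t k‖)
    (hR : 0 ≤ R) (hε : 0 < ε) (hε1 : ε ≤ 1)
    (hδ : 0 < δ) (hδ' : δ ≤ 1 / 4) (hs : (-(1 / 2) ≤ s ∧ s ≤ 0) ∨ s = 1) :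
    wl2 s (fun n : ℤ => ‖Complex.exp (-(Complex.I * n ^ 3 * τ)) * w τ n - w 0 n‖) ≤
      ENNReal.ofReal (nearLinearConst R δ * √(1 + τ ^ 2) * ε ^ (1 / 2 - s - 2 * δ)) := by
  have h0 : (0 : ℝ) ∈ Set.uIcc 0 τ := Set.left_mem_uIcc
  have hτ : τ ∈ Set.uIcc 0 τ := Set.right_mem_uIcc
  have hJ : Convex ℝ (Set.uIcc 0 τ) := convex_uIcc 0 τ
  set P : ℝ := ε ^ (1 / 2 - s - 2 * δ)
  have hP : 0 ≤ P := by positivity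
  set c : ℝ := (corrConst R δ + derivConst R δ).toReal with hc
  have hc0 : 0 ≤ c := ENNReal.toReal_nonneg
  set B : ℝ := c * P
  have hB : 0 ≤ B := by positivity
  have hcB : (corrConst R δ + derivConst R δ) * ENNReal.ofReal P = ENNReal.ofReal B := by
    rw [ENNReal.ofReal_mul hc0, hc, ENNReal.ofReal_toReal
      (ENNReal.add_ne_top.2 ⟨corrConst_ne_top R hδ, derivConst_ne_top R hδ⟩)]
  have hcorr : ∀ t ∈ Set.uIcc 0 τ, DualBound (fun n : ℤ => ENNReal.ofReal (|(n : ℝ)| ^ s) *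
      ‖nf₁ (w t) n + 2 * nf₂ (w t) n‖ₑ) (ENNReal.ofReal B) := fun t ht =>
    ((hz t ht).corr_bound hR hε hε1 hδ hδ' hs).mono (fun _ _ => le_rfl)
      (by rw [← hcB]; gcongr; exact le_self_add)
  have hder : ∀ t ∈ Set.uIcc 0 τ, DualBound (fun n : ℤ => ENNReal.ofReal (|(n : ℝ)| ^ s) *
      ‖6 * Complex.I * (quart (w t) n - w t n * w t (-n) * w t n / n)‖ₑ) (ENNReal.ofReal B) :=
    fun t ht => ((hz t ht).deriv_bound (hreal t ht) hR hε hε1 hδ hδ' hs).mono (fun _ _ => le_rfl)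
      (by rw [← hcB]; gcongr; exact le_add_self)
  set d : ℤ → ℂ := fun n => Complex.exp (-(Complex.I * n ^ 3 * τ)) * w τ n - w 0 n with hd
  have hd0 : d 0 = 0 := by simp [hd, hw.zero h0, hw.zero hτ]
  have hsqrt : 1 ≤ √(1 + τ ^ 2) ∧ |τ| ≤ √(1 + τ ^ 2) :=
    ⟨Real.one_le_sqrt.2 (by nlinarith [sq_nonneg τ]), Real.abs_le_sqrt (by linarith)⟩
  have hBd : nearLinearConst R δ * √(1 + τ ^ 2) * P = 3 * √(1 + τ ^ 2) * B := by
    simp only [nearLinearConst, B, hc]; ring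
  rw [hBd]
  refine wl2_le_of_sum_le (fun _ => norm_nonneg _) (norm_eq_zero.2 hd0) (by positivity)
    fun H hH => ?_
  set S : ℝ := ∑ n ∈ H, (|(n : ℝ)| ^ s * ‖d n‖) ^ 2 with hS
  have hS0 : 0 ≤ S := Finset.sum_nonneg fun _ _ => sq_nonneg _
  -- By duality it suffices to test against the difference itself.
  set a : ℤ → ℝ := fun n => |(n : ℝ)| ^ s * ‖d n‖ with ha
  have ha0 : ∀ n, 0 ≤ a n := fun n => by positivity
  set b : ℤ → ℂ := fun n => (|(n : ℝ)| ^ s : ℝ) * conj (d n) * (|(n : ℝ)| ^ s : ℝ) with hb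
  have hbn : ∀ n, ‖b n‖ = a n * |(n : ℝ)| ^ s := fun n => by
    have : 0 ≤ |(n : ℝ)| ^ s := by positivity
    simp only [hb, ha, norm_mul, Complex.norm_real, Complex.norm_conj, Real.norm_of_nonneg this]
  have hne : ∀ n ∈ H, n ≠ 0 := fun n hn h => hH (h ▸ hn)
  have hmvt : ‖∑ n ∈ H, b n * normalForm w n τ - ∑ n ∈ H, b n * normalForm w n 0‖
      ≤ B * √S * ‖τ - 0‖ := by
    refine hJ.norm_image_sub_le_of_norm_hasDerivWithin_le
      (f := fun t => ∑ n ∈ H, b n * normalForm w n t)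
      (fun t ht => HasDerivWithinAt.fun_sum fun n hn =>
        (hw.hasDerivWithinAt_normalForm hJ ht (hne n hn)).const_mul (b n)) (fun t ht => ?_) h0 hτ
    refine (norm_sum_le _ _).trans (le_trans (le_of_eq ?_) ((hder t ht).sum_le hB hH ha0))
    refine Finset.sum_congr rfl fun n _ => ?_
    rw [norm_mul (b n), norm_mul (Complex.exp _), norm_exp_neg_I_mul_pow, one_mul, hbn, mul_assoc]
  have hcb : ∀ t ∈ Set.uIcc 0 τ, ‖∑ n ∈ H, b n * (Complex.exp (-(Complex.I * n ^ 3 * t)) *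
      (nf₁ (w t) n + 2 * nf₂ (w t) n))‖ ≤ B * √S := fun t ht => by
    refine (norm_sum_le _ _).trans (le_trans (le_of_eq ?_) ((hcorr t ht).sum_le hB hH ha0))
    refine Finset.sum_congr rfl fun n _ => ?_
    rw [norm_mul (b n), norm_mul (Complex.exp _), norm_exp_neg_I_mul_pow, one_mul, hbn, mul_assoc]
  have hSeq : (S : ℂ) = (∑ n ∈ H, b n * normalForm w n τ - ∑ n ∈ H, b n * normalForm w n 0)
      - ∑ n ∈ H, b n * (Complex.exp (-(Complex.I * n ^ 3 * τ)) *
          (nf₁ (w τ) n + 2 * nf₂ (w τ) n))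
      + ∑ n ∈ H, b n * (Complex.exp (-(Complex.I * n ^ 3 * (0 : ℝ))) *
          (nf₁ (w 0) n + 2 * nf₂ (w 0) n)) := by
    rw [← Finset.sum_sub_distrib, ← Finset.sum_sub_distrib, ← Finset.sum_add_distrib, hS,
      Complex.ofReal_sum]
    refine Finset.sum_congr rfl fun n _ => ?_
    have e1 : (((|(n : ℝ)| ^ s * ‖d n‖) ^ 2 : ℝ) : ℂ) = b n * d n := by
      have := Complex.conj_mul' (d n)
      simp only [hb]
      push_cast
      rw [mul_pow, ← this]
      ring
    rw [e1]
    simp only [hd, normalForm, Complex.ofReal_zero, mul_zero, neg_zero, Complex.exp_zero]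
    ring
  have hSle : S ≤ 3 * √(1 + τ ^ 2) * B * √S := by
    have hnS : ‖(S : ℂ)‖ = S := by rw [Complex.norm_real, Real.norm_of_nonneg hS0]
    have hBS : 0 ≤ B * √S := by positivity
    calc S = ‖(S : ℂ)‖ := hnS.symm
      _ ≤ B * √S * ‖τ - 0‖ + B * √S + B * √S := by
          rw [hSeq]
          exact (norm_add_le _ _).trans (add_le_add ((norm_sub_le _ _).trans
            (add_le_add hmvt (hcb τ hτ))) (hcb 0 h0))
      _ = B * √S * (|τ| + 1 + 1) := by rw [sub_zero, Real.norm_eq_abs]; ring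
      _ ≤ B * √S * (3 * √(1 + τ ^ 2)) := by gcongr; linarith [hsqrt.1, hsqrt.2]
      _ = _ := by ring
  have hsq : √S ^ 2 = S := Real.sq_sqrt hS0
  have hfin : √S ≤ 3 * √(1 + τ ^ 2) * B := by
    rcases (Real.sqrt_nonneg S).eq_or_lt with h | h
    · rw [← h]; positivity
    · refine le_of_mul_le_mul_right ?_ h
      rw [← sq, hsq]
      exact hSle
  rw [← hsq]
  gcongr

/-! ### The bootstrap -/

theorem l2e_add_le (p q : ℤ → ℝ≥0∞) : l2e (fun k => p k + q k) ≤ l2e p + l2e q := by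
  have h := ENNReal.lintegral_Lp_add_le
    (μ := (MeasureTheory.Measure.count : MeasureTheory.Measure ℤ))
    (p := 2) (f := p) (g := q) (measurable_of_countable _).aemeasurable
    (measurable_of_countable _).aemeasurable (by norm_num)
  simpa [MeasureTheory.lintegral_count, l2e] using h

section WeightedNorm

variable {s : ℝ} {u v : ℤ → ℂ}

theorem wl2_sq_summand (s : ℝ) (u : ℤ → ℂ) (k : ℤ) :
    ENNReal.ofReal (|(k : ℝ)| ^ s * ‖u k‖) ^ (2 : ℝ) =
      ENNReal.ofReal (|(k : ℝ)| ^ (2 * s) * ‖u k‖ ^ 2) := by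
  rw [ENNReal.ofReal_rpow_of_nonneg (by positivity) (by norm_num), Real.rpow_ofNat, mul_pow,
    ← Real.rpow_natCast (|(k : ℝ)| ^ s), ← Real.rpow_mul (abs_nonneg _)]
  congr 3
  push_cast
  ring

theorem memWeighted_iff : MemWeighted s u ↔ wl2 s (fun k => ‖u k‖) ≠ ⊤ := by
  have h0 : ∀ k : ℤ, 0 ≤ |(k : ℝ)| ^ (2 * s) * ‖u k‖ ^ 2 := fun k => by positivity
  have : wl2 s (fun k => ‖u k‖) ≠ ⊤ ↔
      ∑' k : ℤ, ENNReal.ofReal (|(k : ℝ)| ^ (2 * s) * ‖u k‖ ^ 2) ≠ ⊤ := by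
    unfold wl2 l2e
    simp_rw [wl2_sq_summand]
    rw [not_iff_not, ENNReal.rpow_eq_top_iff_of_pos (by norm_num)]
  rw [this]
  exact ⟨fun h => h.tsum_ofReal_ne_top, summable_of_tsum_ofReal_ne_top h0⟩

theorem ofReal_weightedNorm (h : MemWeighted s u) :
    ENNReal.ofReal (weightedNorm s u) = wl2 s (fun k => ‖u k‖) := by
  have h0 : ∀ k : ℤ, 0 ≤ |(k : ℝ)| ^ (2 * s) * ‖u k‖ ^ 2 := fun k => by positivity
  unfold wl2 l2e weightedNorm
  simp_rw [wl2_sq_summand]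
  rw [← ENNReal.ofReal_tsum_of_nonneg h0 h, Real.sqrt_eq_rpow,
    ENNReal.ofReal_rpow_of_nonneg (tsum_nonneg h0) (by norm_num)]

theorem weightedNorm_nonneg (s : ℝ) (u : ℤ → ℂ) : 0 ≤ weightedNorm s u := Real.sqrt_nonneg _

theorem wl2_le_of_weightedNorm_le {B : ℝ} (h : MemWeighted s u) (hB : weightedNorm s u ≤ B) :
    wl2 s (fun k => ‖u k‖) ≤ ENNReal.ofReal B := by
  rw [← ofReal_weightedNorm h]
  exact ENNReal.ofReal_le_ofReal hB

theorem weightedNorm_le_of_wl2_le {B : ℝ} (hB : 0 ≤ B)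
    (h : wl2 s (fun k => ‖u k‖) ≤ ENNReal.ofReal B) : MemWeighted s u ∧ weightedNorm s u ≤ B := by
  have hm : MemWeighted s u := memWeighted_iff.2 (ne_top_of_le_ne_top ENNReal.ofReal_ne_top h)
  rw [← ofReal_weightedNorm hm, ENNReal.ofReal_le_ofReal_iff hB] at h
  exact ⟨hm, h⟩

theorem weightedNorm_add_le (hu : MemWeighted s u) (hv : MemWeighted s v) :
    MemWeighted s (fun k => u k + v k) ∧
      weightedNorm s (fun k => u k + v k) ≤ weightedNorm s u + weightedNorm s v := by
  refine weightedNorm_le_of_wl2_le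
    (add_nonneg (weightedNorm_nonneg _ _) (weightedNorm_nonneg _ _)) ?_
  rw [ENNReal.ofReal_add (weightedNorm_nonneg _ _) (weightedNorm_nonneg _ _),
    ofReal_weightedNorm hu, ofReal_weightedNorm hv]
  refine le_trans (l2e_mono fun k => ?_) (l2e_add_le _ _)
  rw [← ENNReal.ofReal_add (by positivity) (by positivity), ← mul_add]
  gcongr
  exact norm_add_le _ _

theorem weightedNorm_neg (s : ℝ) (u : ℤ → ℂ) :
    weightedNorm s (fun k => -u k) = weightedNorm s u := by simp [weightedNorm]

theorem MemWeighted.neg (hu : MemWeighted s u) : MemWeighted s (fun k => -u k) := by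
  simpa [MemWeighted] using hu

theorem abs_weightedNorm_sub_le (hu : MemWeighted s u) (hv : MemWeighted s v) :
    |weightedNorm s u - weightedNorm s v| ≤ weightedNorm s (fun k => u k - v k) := by
  have hd : MemWeighted s (fun k => u k - v k) := by
    simpa [sub_eq_add_neg] using (weightedNorm_add_le hu hv.neg).1
  have h1 : weightedNorm s u ≤ weightedNorm s (fun k => u k - v k) + weightedNorm s v := by
    simpa using (weightedNorm_add_le hd hv).2
  have h2 : weightedNorm s v ≤ weightedNorm s (fun k => u k - v k) + weightedNorm s u := by
    have := (weightedNorm_add_le hd.neg hu).2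
    rw [weightedNorm_neg] at this
    simpa using this
  rw [abs_le]
  constructor <;> linarith

/-- The `ℓ²` norm is dominated by the `ℓ²_{3/2}` norm on sequences without zero mode. -/
theorem weightedNorm_zero_le (hu0 : u 0 = 0) (hu : MemWeighted (3 / 2) u) :
    MemWeighted 0 u ∧ weightedNorm 0 u ≤ weightedNorm (3 / 2) u := by
  refine weightedNorm_le_of_wl2_le (weightedNorm_nonneg _ _) ?_
  rw [ofReal_weightedNorm hu]
  refine l2e_mono fun k => ENNReal.ofReal_le_ofReal ?_
  rcases eq_or_ne k 0 with rfl | hk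
  · simp [hu0]
  · gcongr
    · exact one_le_abs_cast hk
    · norm_num

theorem wl2_vHat (hu0 : u 0 = 0) (s : ℝ) :
    wl2 s (fun k => ‖vHat u k‖) = wl2 (s + 1 / 2) (fun k => ‖u k‖) := by
  unfold wl2
  congr 1
  funext k
  congr 1
  change |(k : ℝ)| ^ s * ‖vHat u k‖ = |(k : ℝ)| ^ (s + 1 / 2) * ‖u k‖
  rcases eq_or_ne k 0 with rfl | hk
  · simp [hu0, vHat]
  · have hx : 0 < |(k : ℝ)| := by positivity
    rw [vHat, norm_mul, Complex.norm_real, Real.norm_of_nonneg (Real.sqrt_nonneg _),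
      Real.rpow_add hx, Real.sqrt_eq_rpow, mul_assoc]

theorem vHat_neg (hreal : ∀ n, u (-n) = conj (u n)) (n : ℤ) :
    vHat u (-n) = conj (vHat u n) := by
  simp [vHat, hreal]

theorem highFreq_vHat {ρ ε : ℝ} (hu : u ∈ XSet ρ ε) : HighFreq ρ ε fun k => ‖vHat u k‖ := by
  obtain ⟨h0, -, hm, hle, hm', hle'⟩ := hu
  refine ⟨fun _ => norm_nonneg _, by simp [vHat], ?_, ?_⟩
  · rw [wl2_vHat h0]
    rw [Real.sqrt_eq_rpow] at hle
    norm_num only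
    exact wl2_le_of_weightedNorm_le hm hle
  · rw [wl2_vHat h0]
    rw [Real.rpow_neg_one, ← div_eq_mul_inv]
    norm_num only
    exact wl2_le_of_weightedNorm_le hm' hle'

end WeightedNorm

theorem IsKdVSolution.continuousOn_weightedNorm {I : Set ℝ} {u : ℝ → ℤ → ℂ}
    (hu : IsKdVSolution I u) :
    ContinuousOn (fun t => weightedNorm 0 (u t)) I ∧
      ContinuousOn (fun t => weightedNorm (3 / 2) (u t)) I := by
  have key : ∀ s, (∀ t ∈ I, MemWeighted s (u t)) → (∀ t ∈ I, ∀ r ∈ I,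
      weightedNorm s (fun n => u r n - u t n) ≤ weightedNorm (3 / 2) (fun n => u r n - u t n)) →
      ContinuousOn (fun t => weightedNorm s (u t)) I := by
    intro s hm hle t ht
    rw [ContinuousWithinAt, tendsto_iff_dist_tendsto_zero]
    refine squeeze_zero' (Eventually.of_forall fun _ => dist_nonneg) ?_ (hu.continuous t ht)
    filter_upwards [self_mem_nhdsWithin] with r hr
    rw [Real.dist_eq]
    exact (abs_weightedNorm_sub_le (hm r hr) (hm t ht)).trans (hle t ht r hr)
  refine ⟨key 0 (fun t ht => (weightedNorm_zero_le (hu.zero_mode t ht) (hu.mem t ht)).1) ?_,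
    key _ hu.mem fun _ _ _ _ => le_rfl⟩
  intro t ht r hr
  have hd : MemWeighted (3 / 2) (fun k => u r k - u t k) := by
    simpa [sub_eq_add_neg] using (weightedNorm_add_le (hu.mem r hr) (hu.mem t ht).neg).1
  exact (weightedNorm_zero_le (by rw [hu.zero_mode r hr, hu.zero_mode t ht, sub_zero]) hd).2

/-- On a time interval on which it stays in `X_ε^R`, a solution is a bounded solution. -/
theorem IsKdVSolution.isBoundedSolution {I J : Set ℝ} {u : ℝ → ℤ → ℂ} {R ε : ℝ}
    (hu : IsKdVSolution I u) (hJI : J ⊆ I) (hR : 0 ≤ R) (hε : 0 < ε)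
    (hX : ∀ t ∈ J, u t ∈ XSet R ε) :
    IsBoundedSolution J (fun t => vHat (u t)) (R * ε ^ (-1 : ℝ)) (4 * R ^ 2) := by
  refine ⟨by positivity, by positivity, fun t ht k => ?_, fun t ht k => ?_, fun t ht n => ?_⟩
  · have hz := highFreq_vHat (hX t ht)
    have := le_of_wl2_le (by positivity) hz.high k
    rw [Real.rpow_one] at this
    unfold invMajorant
    rcases eq_or_ne k 0 with rfl | hk
    · simp [vHat]
    · have hx : 0 < |(k : ℝ)| := by positivity
      rw [← div_eq_mul_inv, le_div_iff₀ hx, mul_comm]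
      exact this
  · exact (highFreq_vHat (hX t ht)).norm_conv_le hR hε k
  · refine ((hu.equation t (hJI ht) n).mono hJI).congr_deriv ?_
    rw [kdvRHS, conv, mul_pow, Complex.I_pow_three]
    ring

/-- Near-linear evolution, in the variables `u`. -/
theorem IsKdVSolution.weightedNorm_sub_le {I : Set ℝ} {u : ℝ → ℤ → ℂ} {R ε δ s τ : ℝ}
    (hI : I.OrdConnected) (h0I : (0 : ℝ) ∈ I) (hτ : τ ∈ I)
    (hu : IsKdVSolution I u) (hX : ∀ t ∈ Set.uIcc 0 τ, u t ∈ XSet R ε)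
    (hR : 0 ≤ R) (hε : 0 < ε) (hε1 : ε ≤ 1)
    (hδ : 0 < δ) (hδ' : δ ≤ 1 / 4) (hs : (-(1 / 2) ≤ s ∧ s ≤ 0) ∨ s = 1) :
    MemWeighted (s + 1 / 2)
        (fun n : ℤ => u τ n - Complex.exp (Complex.I * (n : ℂ) ^ 3 * (τ : ℂ)) * u 0 n) ∧
      weightedNorm (s + 1 / 2)
        (fun n : ℤ => u τ n - Complex.exp (Complex.I * (n : ℂ) ^ 3 * (τ : ℂ)) * u 0 n) ≤
        nearLinearConst R δ * √(1 + τ ^ 2) * ε ^ (1 / 2 - s - 2 * δ) := by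
  have hJI : Set.uIcc 0 τ ⊆ I := hI.uIcc_subset h0I hτ
  have h := (hu.isBoundedSolution hJI hR hε hX).wl2_sub_le
    (fun t ht n => vHat_neg (hu.real t (hJI ht)) n) (fun t ht => highFreq_vHat (hX t ht))
    hR hε hε1 hδ hδ' hs
  refine weightedNorm_le_of_wl2_le
    (mul_nonneg (mul_nonneg (nearLinearConst_nonneg _ _) (by positivity)) (by positivity)) ?_
  rw [← wl2_vHat (by simp [hu.zero_mode τ hτ, hu.zero_mode 0 h0I])]
  refine le_of_eq_of_le ?_ h
  congr 1
  funext n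
  have hcancel : Complex.exp (-(Complex.I * (n : ℂ) ^ 3 * τ)) *
      Complex.exp (Complex.I * (n : ℂ) ^ 3 * τ) = 1 := by
    rw [← Complex.exp_add]; simp
  calc _ = ‖Complex.exp (-(Complex.I * (n : ℂ) ^ 3 * τ))‖ *
        ‖vHat (fun n : ℤ =>
          u τ n - Complex.exp (Complex.I * (n : ℂ) ^ 3 * (τ : ℂ)) * u 0 n) n‖ := by
        rw [norm_exp_neg_I_mul_pow, one_mul]
    _ = _ := by
        rw [← norm_mul]
        congr 1
        simp only [vHat]
        linear_combination (-((√|(n : ℝ)| : ℝ) : ℂ) * u 0 n) * hcancel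

theorem weightedNorm_exp_mul (s τ : ℝ) (u : ℤ → ℂ) :
    weightedNorm s (fun n : ℤ => Complex.exp (Complex.I * (n : ℂ) ^ 3 * (τ : ℂ)) * u n) =
      weightedNorm s u ∧
    (MemWeighted s u →
      MemWeighted s (fun n : ℤ => Complex.exp (Complex.I * (n : ℂ) ^ 3 * (τ : ℂ)) * u n)) := by
  simp [weightedNorm, MemWeighted, norm_exp_I_mul_pow]

/-- A continuity argument: a continuous function that starts below `2` and cannot reach `2` as
long as it stays below `2` remains below `2`. -/
theorem le_two_of_continuous_induction {m : ℝ → ℝ} (hm : ContinuousOn m (Set.Icc 0 1))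
    (h0 : m 0 ≤ 1) (h : ∀ x ∈ Set.Icc (0 : ℝ) 1, (∀ y ∈ Set.Icc 0 x, m y ≤ 2) → m x < 2) :
    ∀ x ∈ Set.Icc (0 : ℝ) 1, m x ≤ 2 := by
  by_contra! hcon
  obtain ⟨z, hz, hz2⟩ := hcon
  -- The first time at which the value `2` is reached.
  have hK : IsCompact (Set.Icc (0 : ℝ) 1 ∩ m ⁻¹' Set.Ici 2) :=
    isCompact_Icc.of_isClosed_subset (hm.preimage_isClosed_of_isClosed isClosed_Icc isClosed_Ici)
      Set.inter_subset_left
  obtain ⟨x, ⟨hx, hx2⟩, hmin⟩ := hK.exists_isLeast ⟨z, hz, hz2.le⟩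
  have hx2' : 2 ≤ m x := hx2
  have hlt : ∀ y ∈ Set.Icc 0 x, y ≠ x → m y < 2 := by
    intro y hy hyx
    by_contra! hge
    exact hyx (le_antisymm hy.2 (hmin ⟨⟨hy.1, hy.2.trans hx.2⟩, hge⟩))
  have hmx : m x ≤ 2 := by
    obtain ⟨y, hy, hy2⟩ := intermediate_value_Icc hx.1
      (hm.mono (Set.Icc_subset_Icc_right hx.2)) (show (2 : ℝ) ∈ Set.Icc (m 0) (m x) from
        ⟨by linarith, hx2'⟩)
    rcases eq_or_ne y x with rfl | hyx
    · exact hy2.le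
    · exact absurd hy2 (hlt y hy hyx).ne
  have := h x hx fun y hy => by
    rcases eq_or_ne y x with rfl | hyx
    · exact hmx
    · exact (hlt y hy hyx).le
  linarith

/-- The bootstrap: the solution stays in `X_ε^{2ρ}` as long as `⟨t⟩` times the rate
`ε^{1/2-2δ}` is small compared to `ρ`. -/
theorem IsKdVSolution.mem_XSet {I : Set ℝ} {u : ℝ → ℤ → ℂ} {ρ ε δ T : ℝ}
    (hI : I.OrdConnected) (h0I : (0 : ℝ) ∈ I) (hT : T ∈ I) (hu : IsKdVSolution I u)
    (hρ : 0 < ρ) (hε : 0 < ε) (hε1 : ε ≤ 1) (hδ : 0 < δ) (hδ' : δ ≤ 1 / 4)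
    (hu0 : u 0 ∈ XSet ρ ε)
    (hsmall : nearLinearConst (2 * ρ) δ * √(1 + T ^ 2) * ε ^ (1 / 2 - 2 * δ) < ρ) :
    ∀ t ∈ Set.uIcc 0 T, u t ∈ XSet (2 * ρ) ε := by
  have hJI : Set.uIcc 0 T ⊆ I := hI.uIcc_subset h0I hT
  have hse : 0 < √ε := Real.sqrt_pos.2 hε
  set m : ℝ → ℝ := fun x => max (weightedNorm 0 (u (x * T)) / (ρ * √ε))
    (weightedNorm (3 / 2) (u (x * T)) / (ρ / ε)) with hm
  have hmem : ∀ x ∈ Set.Icc (0 : ℝ) 1, x * T ∈ I := fun x hx => hJI (by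
    have := (convex_uIcc 0 T).add_smul_sub_mem Set.left_mem_uIcc Set.right_mem_uIcc hx
    simpa using this)
  have hmX : ∀ x ∈ Set.Icc (0 : ℝ) 1, m x ≤ 2 → u (x * T) ∈ XSet (2 * ρ) ε := by
    intro x hx hmx
    have hxI := hmem x hx
    obtain ⟨h1, h2⟩ := max_le_iff.1 hmx
    rw [div_le_iff₀ (by positivity)] at h1 h2
    exact ⟨hu.zero_mode _ hxI, hu.real _ hxI, (weightedNorm_zero_le (hu.zero_mode _ hxI)
      (hu.mem _ hxI)).1, by linarith, hu.mem _ hxI, by rw [mul_div_assoc]; exact h2⟩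
  have hcont : ContinuousOn m (Set.Icc 0 1) := by
    have hmap : ContinuousOn (fun x : ℝ => x * T) (Set.Icc 0 1) := by fun_prop
    exact ((hu.continuousOn_weightedNorm.1.comp hmap hmem).div_const _).sup
      ((hu.continuousOn_weightedNorm.2.comp hmap hmem).div_const _)
  obtain ⟨h00, -, h0m, h0le, h0m', h0le'⟩ := hu0
  have key : ∀ x ∈ Set.Icc (0 : ℝ) 1, m x ≤ 2 := by
    refine le_two_of_continuous_induction hcont ?_ fun x hx hle => ?_
    · simp only [hm, zero_mul]
      exact max_le ((div_le_one (by positivity)).2 h0le) ((div_le_one (by positivity)).2 h0le')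
    · have hxI := hmem x hx
      have hXx : ∀ t ∈ Set.uIcc 0 (x * T), u t ∈ XSet (2 * ρ) ε := by
        intro t ht
        have hseg : t ∈ segment ℝ 0 (x * T) := by rwa [segment_eq_uIcc]
        rw [segment_eq_image_lineMap] at hseg
        obtain ⟨y, hy, rfl⟩ := hseg
        have hyx : y * x ∈ Set.Icc 0 x := ⟨mul_nonneg hy.1 hx.1, mul_le_of_le_one_left hx.1 hy.2⟩
        have := hmX (y * x) ⟨hyx.1, hyx.2.trans hx.2⟩ (hle _ hyx)
        simpa [AffineMap.lineMap_apply, mul_assoc] using this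
      have hC := nearLinearConst_nonneg (2 * ρ) δ
      have hsq : √(1 + (x * T) ^ 2) ≤ √(1 + T ^ 2) := by
        refine Real.sqrt_le_sqrt ?_
        have : x ^ 2 ≤ 1 := pow_le_one₀ hx.1 hx.2
        nlinarith [sq_nonneg T]
      have est : ∀ s, ((-(1 / 2) ≤ s ∧ s ≤ 0) ∨ s = 1) → MemWeighted (s + 1 / 2) (u 0) →
          weightedNorm (s + 1 / 2) (u (x * T)) < weightedNorm (s + 1 / 2) (u 0) + ρ * ε ^ (-s) := by
        intro s hs hmem0
        obtain ⟨hd, hdle⟩ := hu.weightedNorm_sub_le hI h0I hxI hXx (by positivity) hε hε1 hδ hδ' hs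
        have he := weightedNorm_exp_mul (s + 1 / 2) (x * T) (u 0)
        have hadd := (weightedNorm_add_le hd (he.2 hmem0)).2
        rw [he.1] at hadd
        simp only [sub_add_cancel] at hadd
        refine hadd.trans_lt ?_
        rw [add_comm]
        refine add_lt_add_right (hdle.trans_lt ?_) _
        have hpow : ε ^ (1 / 2 - s - 2 * δ) = ε ^ (1 / 2 - 2 * δ) * ε ^ (-s) := by
          rw [← Real.rpow_add hε]; ring_nf
        rw [hpow, ← mul_assoc]
        refine mul_lt_mul_of_pos_right (lt_of_le_of_lt ?_ hsmall) (by positivity)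
        gcongr
      have e1 := est (-(1 / 2)) (Or.inl (by norm_num)) (by norm_num; exact h0m)
      have e2 := est 1 (Or.inr rfl) (by norm_num; exact h0m')
      norm_num only at e1 e2
      rw [← Real.sqrt_eq_rpow] at e1
      rw [Real.rpow_neg_one, ← div_eq_mul_inv] at e2
      refine max_lt ?_ ?_
      · rw [div_lt_iff₀ (by positivity)]; linarith
      · rw [div_lt_iff₀ (by positivity)]; linarith
  intro t ht
  have hseg : t ∈ segment ℝ 0 T := by rwa [segment_eq_uIcc]
  rw [segment_eq_image_lineMap] at hseg
  obtain ⟨y, hy, rfl⟩ := hseg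
  simpa [AffineMap.lineMap_apply] using hmX y hy (key y hy)

/-- On the time scale `ε^{-1/2+γ}` the near-linearity error stays below the size of the data. -/
theorem exists_small {c K γ δ ρ : ℝ} (hc : 0 ≤ c) (hρ : 0 < ρ) (hδ : 2 * δ < 1 / 2)
    (hγ : 2 * δ < γ) :
    ∃ ε₀ > (0 : ℝ), ∀ ε : ℝ, 0 < ε → ε < ε₀ → ε ≤ 1 ∧ ∀ t : ℝ, |t| ≤ K * ε ^ (-(1 / 2) + γ : ℝ) →
      c * √(1 + t ^ 2) * ε ^ (1 / 2 - 2 * δ) < ρ := by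
  have hlim : Tendsto (fun ε : ℝ => c * (ε ^ (1 / 2 - 2 * δ) + K * ε ^ (γ - 2 * δ)))
      (𝓝[>] 0) (𝓝 0) := by
    have h1 : ∀ p : ℝ, 0 < p → Tendsto (fun ε : ℝ => ε ^ p) (𝓝[>] 0) (𝓝 0) := fun p hp => by
      have := (Real.continuousAt_rpow_const 0 p (Or.inr hp.le)).tendsto
      rw [Real.zero_rpow hp.ne'] at this
      exact this.mono_left nhdsWithin_le_nhds
    have := (((h1 (1 / 2 - 2 * δ) (by linarith)).add
      ((h1 (γ - 2 * δ) (by linarith)).const_mul K))).const_mul c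
    simpa using this
  have hev := (hlim.eventually (gt_mem_nhds hρ))
  obtain ⟨ε₁, hε₁, hsub⟩ := mem_nhdsGT_iff_exists_Ioo_subset.1 hev
  refine ⟨min ε₁ 1, lt_min hε₁ one_pos, fun ε hε hlt => ⟨(hlt.trans_le (min_le_right _ _)).le,
    fun t ht => lt_of_le_of_lt ?_ (hsub ⟨hε, hlt.trans_le (min_le_left _ _)⟩)⟩⟩
  have hsq : √(1 + t ^ 2) ≤ 1 + |t| := by
    rw [Real.sqrt_le_left (by positivity)]
    nlinarith [abs_nonneg t, sq_abs t]
  calc c * √(1 + t ^ 2) * ε ^ (1 / 2 - 2 * δ)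
      ≤ c * (1 + K * ε ^ (-(1 / 2) + γ : ℝ)) * ε ^ (1 / 2 - 2 * δ) := by
        gcongr
        linarith
    _ = c * (ε ^ (1 / 2 - 2 * δ) + K * (ε ^ (-(1 / 2) + γ : ℝ) * ε ^ (1 / 2 - 2 * δ))) := by ring
    _ = _ := by
        rw [← Real.rpow_add hε]
        ring_nf

theorem theorem2 (ρ : ℝ) (hρ : 0 < ρ) :
    ∃ C : ℝ → ℝ, ∀ γ > (0 : ℝ), ∀ K > (0 : ℝ), ∃ ε₀ > (0 : ℝ), ∀ ε : ℝ, 0 < ε → ε < ε₀ →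
      ∀ (I : Set ℝ) (u : ℝ → ℤ → ℂ), I.OrdConnected → (0 : ℝ) ∈ I →
        IsKdVSolution I u → u 0 ∈ XSet ρ ε →
        ∀ t ∈ I, |t| ≤ K * ε ^ (-(1 / 2) + γ : ℝ) →
          u t ∈ XSet (2 * ρ) ε ∧
          MemWeighted (1 / 2)
            (fun n : ℤ => u t n - Complex.exp (Complex.I * (n : ℂ) ^ 3 * (t : ℂ)) * u 0 n) ∧
          ∀ δ > (0 : ℝ),
            weightedNorm (1 / 2)
              (fun n : ℤ => u t n - Complex.exp (Complex.I * (n : ℂ) ^ 3 * (t : ℂ)) * u 0 n)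
            ≤ C δ * Real.sqrt (1 + t ^ 2) * ε ^ (1 / 2 - δ : ℝ) := by
  refine ⟨fun δ => nearLinearConst (2 * ρ) (min (δ / 2) (1 / 8)), fun γ hγ K _ => ?_⟩
  -- Half of the room `γ` in the time scale pays for the loss `2 δ₀` of the estimates.
  set δ₀ : ℝ := min (γ / 4) (1 / 8) with hδ₀
  have hδ₀pos : 0 < δ₀ := lt_min (by positivity) (by norm_num)
  have hδ₀γ : δ₀ ≤ γ / 4 := min_le_left _ _
  have hδ₀8 : δ₀ ≤ 1 / 8 := min_le_right _ _
  obtain ⟨ε₀, hε₀, hsmall⟩ := exists_small (K := K) (γ := γ) (δ := δ₀)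
    (nearLinearConst_nonneg (2 * ρ) δ₀) hρ (by linarith) (by linarith)
  refine ⟨ε₀, hε₀, fun ε hε hlt I u hI h0I hu hu0 t ht htle => ?_⟩
  obtain ⟨hε1, hsm⟩ := hsmall ε hε hlt
  have hX := hu.mem_XSet hI h0I ht hρ hε hε1 hδ₀pos (by linarith) hu0 (hsm t htle)
  have est : ∀ δ : ℝ, 0 < δ → δ ≤ 1 / 4 → _ := fun δ h h' =>
    hu.weightedNorm_sub_le hI h0I ht hX (by positivity) hε hε1 h h'
      (s := 0) (Or.inl (by norm_num))
  simp only [zero_add, sub_zero] at est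
  refine ⟨hX t Set.right_mem_uIcc, (est δ₀ hδ₀pos (by linarith)).1, fun δ hδ => ?_⟩
  have hmin : 0 < min (δ / 2) (1 / 8 : ℝ) := lt_min (by positivity) (by norm_num)
  have hmin8 : min (δ / 2) (1 / 8 : ℝ) ≤ 1 / 8 := min_le_right _ _
  have hmin2 : min (δ / 2) (1 / 8 : ℝ) ≤ δ / 2 := min_le_left _ _
  refine (est _ hmin (by linarith)).2.trans ?_
  have hC := nearLinearConst_nonneg (2 * ρ) (min (δ / 2) (1 / 8))
  gcongr ?_ * ?_
  exact Real.rpow_le_rpow_of_exponent_ge hε hε1 (by linarith)
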